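/- Graphs are finite and may have loops and parallel edges; embeddings are cellular embeddings of connected graphs in closed orientable surfaces. For a connected graph $G$ let $\beta(G)=|E(G)|-|V(G)|+1$ be its Betti number, $\gamma_M(G)$ the largest genus of a surface in which $G$ embeds, and $\xi(G)=\beta(G)-2\gamma_M(G)$. A connected graph is upper-embeddable if it has an embedding with at most two faces, and two-face-embeddable if it has an embedding with exactly two faces. A cubic graph $G$ is amply two-face-embeddable if it is two-face-embeddable and has a removable pair, that is, two distinct vertices $x,y$ joined by exactly one edge such that this edge is not a bridge and $G-\{x,y\}$ is (connected and) upper-embeddable. The cotree of a spanning tree $T$ is the spanning subgraph $G-E(T)$; a component of it is odd if it has an odd number of edges, and heavy if it has at least three edges and their number has the same parity as $\beta(G)$. A Xuong tree of $G$ is a spanning tree whose cotree has exactly $\xi(G)$ odd components. A coherent decycling partition of $G$ is a partition $\{A,J\}$ of $V(G)$ such that $A$ induces a tree and $J$ induces a subgraph with at most one edge (loops are counted as edges). Theorem. For every connected cubic graph $G$ the following statements are equivalent. (i) $G$ is amply two-face-embeddable. (ii) $G$ has a Xuong tree whose cotree has a single odd component, and this component is heavy. (iii) $G$ is loopless, its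 order $|V(G)|$ is divisible by $4$, and $G$ admits a coherent decycling partition. In particular, a loopless connected cubic graph of order divisible by $4$ admits a coherent decycling partition if and only if it is amply two-face-embeddable. -/

import Mathlib

/-! Multigraphs (loops and parallel edges allowed) are Mathlib's `Graph α β`, with vertex set
`G.vertexSet : Set α` and edge set `G.edgeSet : Set β`. -/

namespace Graph

/-- `G` is connected: it has a vertex, and any two of its vertices are joined by a walk. -/
def IsConn {α β : Type*} (G : Graph α β) : Prop :=
  G.vertexSet.Nonempty ∧
    ∀ x ∈ G.vertexSet, ∀ y ∈ G.vertexSet, Relation.ReflTransGen G.Adj x y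

/-- The edge `e` of `G` is a bridge: after deleting `e` its two ends are no longer joined by a
walk. A loop is never a bridge. -/
def IsBridge {α β : Type*} (G : Graph α β) (e : β) : Prop :=
  ∃ x y, G.IsLink e x y ∧ ¬ Relation.ReflTransGen (G.deleteEdges {e}).Adj x y

/-- A tree: a connected graph without cycles, that is, a connected graph in which no edge lies on
a cycle, equivalently in which every edge is a bridge. -/
def IsTreeGraph {α β : Type*} (G : Graph α β) : Prop :=
  G.IsConn ∧ ∀ e ∈ G.edgeSet, G.IsBridge e

/-- The degree of a vertex; a loop counts twice. -/
noncomputable def vertexDegree {α β : Type*} (G : Graph α β) (v : α) : ℕ :=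
  {e | G.IsNonloopAt e v}.ncard + 2 * {e | G.IsLoopAt e v}.ncard

/-- Cubic (3-valent) graphs. -/
def IsCubicGraph {α β : Type*} (G : Graph α β) : Prop :=
  ∀ v ∈ G.vertexSet, G.vertexDegree v = 3

/-- The Betti number `|E| - |V| + 1` of a connected graph. -/
noncomputable def bettiNumber {α β : Type*} (G : Graph α β) : ℤ :=
  (G.edgeSet.ncard : ℤ) - (G.vertexSet.ncard : ℤ) + 1

/-- `K` is a connected component of `H`: a nonempty connected subgraph that contains every edge
of `H` incident with one of its vertices. A component may be a single vertex without edges. -/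
def IsComponent {α β : Type*} (K H : Graph α β) : Prop :=
  K.IsClosedSubgraph H ∧ K.IsConn

/-! ### Cellular embeddings in closed orientable surfaces

A cellular embedding of a connected graph in a closed oriented surface is given by a rotation
system: the edges are split into two half-edges (darts) each, and the darts that leave a vertex
are cyclically ordered as they appear around the vertex on the surface. The faces are the orbits
of the permutation that goes along a dart and then takes, at its head, the dart that follows the
reversed dart in the cyclic order. -/

/-- The darts of `G`: each edge, loop or not, has two of them. -/
abbrev DartType {α β : Type*} (G : Graph α β) : Type _ := G.edgeSet × Bool

/-- A rotation system of `G`. -/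
structure RotationSystem {α β : Type*} (G : Graph α β) where
  /-- The vertex that a dart leaves. -/
  tail : G.DartType → α
  /-- The two darts of an edge leave the two ends of the edge. -/
  isLink : ∀ e : G.edgeSet, G.IsLink e.1 (tail (e, false)) (tail (e, true))
  /-- The next dart around the same vertex. -/
  next : Equiv.Perm G.DartType
  /-- The darts that leave a vertex form a single cycle of `next`. -/
  sameCycle_iff : ∀ d d' : G.DartType, next.SameCycle d d' ↔ tail d = tail d'

/-- The reversal of darts. -/
def dartRev {α β : Type*} (G : Graph α β) : Equiv.Perm G.DartType :=
  Equiv.prodCongr (Equiv.refl _) Equiv.boolNot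

/-- The permutation that traces the face boundaries. -/
def RotationSystem.facePerm {α β : Type*} {G : Graph α β} (R : G.RotationSystem) :
    Equiv.Perm G.DartType :=
  R.next * G.dartRev

/-- The number of faces. A connected graph without edges is a single vertex, whose only cellular
embedding is the one in the sphere, with one face; this is the second summand. -/
noncomputable def RotationSystem.numFaces {α β : Type*} {G : Graph α β}
    (R : G.RotationSystem) : ℕ :=
  Nat.card (Quotient (Equiv.Perm.SameCycle.setoid R.facePerm)) +
    {v ∈ G.vertexSet | ∀ e, ¬ G.Inc e v}.ncard

/-- The surface of the embedding has genus `g`, as given by the Euler-Poincaré equation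
`n - m + r = 2 - 2 g`. -/
def RotationSystem.HasGenus {α β : Type*} {G : Graph α β} (R : G.RotationSystem) (g : ℕ) :
    Prop :=
  (G.vertexSet.ncard : ℤ) - (G.edgeSet.ncard : ℤ) + (R.numFaces : ℤ) = 2 - 2 * (g : ℤ)

/-- The maximum genus of a connected graph. (The genus of an embedding is at most half of the
Betti number, so that the supremum is a maximum for every finite connected graph.) -/
noncomputable def maxGenus {α β : Type*} (G : Graph α β) : ℕ :=
  sSup {g : ℕ | ∃ R : G.RotationSystem, R.HasGenus g}

/-- The deficiency `ξ(G) = β(G) - 2 γ_M(G)`. -/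
noncomputable def deficiency {α β : Type*} (G : Graph α β) : ℤ :=
  G.bettiNumber - 2 * (G.maxGenus : ℤ)

/-- Upper-embeddable: connected, with a cellular embedding in a closed orientable surface that
has at most two faces. -/
def IsUpperEmbeddable {α β : Type*} (G : Graph α β) : Prop :=
  G.IsConn ∧ ∃ R : G.RotationSystem, R.numFaces ≤ 2

/-- (Orientably) two-face-embeddable. -/
def IsTwoFaceEmbeddable {α β : Type*} (G : Graph α β) : Prop :=
  G.IsConn ∧ ∃ R : G.RotationSystem, R.numFaces = 2

/-- `{x, y}` is a removable pair: distinct vertices that are joined by exactly one edge, this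
edge is not a bridge, and `G - {x, y}` is upper-embeddable. -/
def IsRemovablePair {α β : Type*} (G : Graph α β) (x y : α) : Prop :=
  x ≠ y ∧ (∃ e, G.IsLink e x y ∧ (∀ f, G.IsLink f x y → f = e) ∧ ¬ G.IsBridge e) ∧
    (G.deleteVerts {x, y}).IsUpperEmbeddable

/-- Amply two-face-embeddable: two-face-embeddable with a removable pair of vertices. -/
def IsAmplyTwoFaceEmbeddable {α β : Type*} (G : Graph α β) : Prop :=
  G.IsTwoFaceEmbeddable ∧ ∃ x y, G.IsRemovablePair x y

/-! ### Spanning trees and cotrees -/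

/-- `T` is a spanning tree of `G`. -/
def IsSpanningTree {α β : Type*} (G T : Graph α β) : Prop :=
  T.IsSpanningSubgraph G ∧ T.IsTreeGraph

/-- The cotree `G - E(T)`, a spanning subgraph of `G`. -/
def cotree {α β : Type*} (G T : Graph α β) : Graph α β := G.deleteEdges T.edgeSet

/-- `K` is an odd component of `H`: a component with an odd number of edges. -/
def IsOddComponent {α β : Type*} (K H : Graph α β) : Prop :=
  K.IsComponent H ∧ Odd K.edgeSet.ncard

/-- A Xuong tree of `G`: a spanning tree whose cotree has exactly `ξ(G)` odd components. -/
def IsXuongTree {α β : Type*} (G T : Graph α β) : Prop :=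
  G.IsSpanningTree T ∧
    ({K : Graph α β | K.IsOddComponent (G.cotree T)}.ncard : ℤ) = G.deficiency

/-- A cotree component `K` is heavy if it has at least three edges and the number of its edges
has the same parity as the Betti number of `G`. -/
def IsHeavy {α β : Type*} (G K : Graph α β) : Prop :=
  3 ≤ K.edgeSet.ncard ∧ (Even K.edgeSet.ncard ↔ Even G.bettiNumber)

/-! ### Decycling partitions -/

/-- `J` is independent: the subgraph induced by `J` has no edge (in particular, no loop). -/
def IsIndepVertexSet {α β : Type*} (G : Graph α β) (J : Set α) : Prop :=
  (G.induce J).edgeSet = ∅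

/-- `J` is near-independent: the subgraph induced by `J` has exactly one edge. -/
def IsNearIndepVertexSet {α β : Type*} (G : Graph α β) (J : Set α) : Prop :=
  (G.induce J).edgeSet.ncard = 1

/-- `{A, J}` is a coherent decycling partition of `G`: a partition of the vertex set such that
`A` induces a tree and `J` is independent or near-independent. -/
def IsCoherentDecyclingPartition {α β : Type*} (G : Graph α β) (A J : Set α) : Prop :=
  A ∪ J = G.vertexSet ∧ Disjoint A J ∧ (G.induce A).IsTreeGraph ∧
    (G.IsIndepVertexSet J ∨ G.IsNearIndepVertexSet J)

end Graph

/-! A rotation system is a permutation ν of the darts whose faces are the cycles of ν * ρ, where ρ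
reverses darts. The proof works with partial systems (`Glued`): some vertices are assembled, and
every other dart is a fixed point of ν, a dangling end. The basic move is `SameCycle.mul_three`: if
three dangling darts occur along a face in the order a, b, c, then a trivalent vertex with rotation
(a b c) can be inserted and the face stays in one piece. Backwards, a trivalent vertex whose
rotation is opposite to the order of its darts along a single face can be dissolved.

(i) and (iii). In a one-face embedding of maximum degree at most three, dissolve such vertices as
long as possible. At the remaining vertices the rotation agrees with the order along the face, so
that the face runs around them as around a plane tree: every edge between them is a bridge
(`exists_separating_set`), and they induce a tree. The dissolved vertices are independent
(`exists_induced_tree`). Conversely, an induced tree and independent trivalent vertices can be glued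
to a one-face embedding (`exists_rotationSystem_of_indep`), and one edge between the added vertices
costs at most one more face (`exists_rotationSystem_of_near_indep`). Comparing signs of permutations
shows that the number of faces has the parity of n + m (`even_numFaces`), which is even for a cubic
graph exactly when 4 divides n. Deleting a removable pair loses 2 vertices and 5 edges, so that an
embedding of the rest with at most two faces has one face; the dissolved vertices together with the
pair form J. In the other direction parity rules out an independent J, and the ends of the one edge
within J are a removable pair.

(ii) and (iii). Given the partition, attach each vertex of J to the tree on A as a leaf. Every
cotree edge then meets J and every vertex of J has two cotree edges, so only the component with the
edge inside J is odd. Conversely, assign the cotree edges to their ends so that a vertex z with two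
cotree edges in the odd component receives an odd number and every other vertex an even number
(`exists_assignment`). The vertices that receive edges form J: they are leaves of the tree, and only
the second cotree edge at z has both ends in J. -/

/-! ### First returns, and permutations modified on a set -/

namespace Equiv.Perm

variable {D : Type*}

/-- Along `f`, the first return of `s` to the set `O` is `t`. -/
def FirstReturn (f : Perm D) (O : Set D) (s t : D) : Prop :=
  t ∈ O ∧ ∃ k, 0 < k ∧ (f ^ k) s = t ∧ ∀ i, 0 < i → i < k → (f ^ i) s ∉ O

lemma SameCycle.rel {f : Perm D} {R : D → D → Prop} (hR : Equivalence R)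
    (h : ∀ d, R d (f d)) {d d' : D} (hd : f.SameCycle d d') : R d d' := by
  obtain ⟨i, rfl⟩ := hd
  induction i using Int.induction_on with
  | zero => exact hR.refl _
  | succ i ih =>
    rw [add_comm, zpow_add, zpow_one]
    exact hR.trans ih (h _)
  | pred i ih =>
    refine hR.trans ih (hR.symm ?_)
    have := h ((f ^ (-(i : ℤ) - 1)) d)
    rwa [← Perm.mul_apply, ← zpow_one_add, show 1 + (-(i : ℤ) - 1) = -i by ring] at this

lemma FirstReturn.unique {f : Perm D} {O : Set D} {s t t' : D} (h : f.FirstReturn O s t)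
    (h' : f.FirstReturn O s t') : t = t' := by
  obtain ⟨ht, k, hk, rfl, hk'⟩ := h
  obtain ⟨ht', l, hl, rfl, hl'⟩ := h'
  rcases lt_trichotomy k l with h | h | h
  · exact absurd ht (hl' k hk h)
  · rw [h]
  · exact absurd ht' (hk' l hl h)

lemma FirstReturn.sameCycle {f : Perm D} {O : Set D} {s t : D} (h : f.FirstReturn O s t) :
    f.SameCycle s t := by
  obtain ⟨-, k, -, rfl, -⟩ := h
  exact ⟨k, by simp⟩

lemma exists_firstReturn_of_pow {f : Perm D} {O : Set D} {s : D} {k : ℕ} (hk : 0 < k)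
    (h : (f ^ k) s ∈ O) : ∃ t, f.FirstReturn O s t := by
  classical
  have hex : ∃ k, 0 < k ∧ (f ^ k) s ∈ O := ⟨k, hk, h⟩
  obtain ⟨h1, h2⟩ := Nat.find_spec hex
  exact ⟨_, h2, Nat.find hex, h1, rfl, fun i hi hi' h' => Nat.find_min hex hi' ⟨hi, h'⟩⟩

lemma exists_firstReturn [Finite D] (f : Perm D) {O : Set D} {s : D} (hs : s ∈ O) :
    ∃ t, f.FirstReturn O s t := by
  have : (f ^ orderOf f) s ∈ O := by simpa [pow_orderOf_eq_one]
  exact exists_firstReturn_of_pow (orderOf_pos f) this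

/-- A set of representatives closed under first returns absorbs every cycle that it meets. -/
lemma mem_of_firstReturn_closed [Finite D] {f : Perm D} {O P : Set D}
    (hP : ∀ s ∈ P, ∀ t, f.FirstReturn O s t → t ∈ P) {s t : D} (hs : s ∈ P) (ht : t ∈ O)
    (h : f.SameCycle s t) : t ∈ P := by
  obtain ⟨k, -, hk⟩ := h.exists_pow_eq'
  induction k using Nat.strong_induction_on generalizing s with
  | _ k ih =>
    rcases Nat.eq_zero_or_pos k with rfl | hpos
    · simpa [← hk] using hs
    obtain ⟨u, hu⟩ := exists_firstReturn_of_pow hpos (hk ▸ ht : (f ^ k) s ∈ O)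
    have huP := hP s hs u hu
    obtain ⟨huO, j, hj, rfl, hj'⟩ := hu
    have hjk : j ≤ k := by
      by_contra hlt
      exact hj' k hpos (by omega) (hk ▸ ht)
    have hkk : (f ^ (k - j)) ((f ^ j) s) = t := by
      rw [← Perm.mul_apply, ← pow_add, Nat.sub_add_cancel hjk, hk]
    exact ih (k - j) (by omega) huP ⟨(k - j : ℕ), by simpa using hkk⟩ hkk

lemma exists_path_from_set [Finite D] {f : Perm D} {O : Set D} {s d : D} (hs : s ∈ O)
    (h : f.SameCycle s d) :
    ∃ s' ∈ O, ∃ k : ℕ, (f ^ k) s' = d ∧ ∀ i, 0 < i → i ≤ k → (f ^ i) s' ∉ O := by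
  classical
  have hex : ∃ k : ℕ, ∃ s' ∈ O, (f ^ k) s' = d := by
    obtain ⟨k, -, hk⟩ := h.exists_pow_eq'
    exact ⟨k, s, hs, hk⟩
  obtain ⟨s', hs', h'⟩ := Nat.find_spec hex
  refine ⟨s', hs', _, h', fun i hi hi' hO => Nat.find_min hex (m := Nat.find hex - i) (by omega)
    ⟨_, hO, ?_⟩⟩
  rw [← Perm.mul_apply, ← pow_add, Nat.sub_add_cancel hi', h']

section Modify

variable {f κ : Perm D} {O : Set D}

/-- As κ acts after `f`, only the points reached matter: the start `s` itself may lie in `O`. -/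
lemma mul_pow_apply_of_avoids (hκ : ∀ x ∉ O, κ x = x) {s : D} {k : ℕ}
    (h : ∀ i, 0 < i → i ≤ k → (f ^ i) s ∉ O) : ((κ * f) ^ k) s = (f ^ k) s := by
  induction k with
  | zero => simp
  | succ k ih =>
    rw [pow_succ', Perm.mul_apply, ih fun i hi hi' => h i hi (by omega), Perm.mul_apply,
      ← Perm.mul_apply f, ← pow_succ']
    exact hκ _ (h _ (by omega) le_rfl)

/-- The modified orbit follows `f` until it is about to enter `O` at `t`, where it is diverted to `κ
t`. -/
lemma FirstReturn.sameCycle_mul (hκ : ∀ x ∉ O, κ x = x) {s t : D} (h : f.FirstReturn O s t) :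
    (κ * f).SameCycle s (κ t) := by
  obtain ⟨-, k, hk, rfl, hk'⟩ := h
  obtain ⟨k, rfl⟩ : ∃ l, k = l + 1 := ⟨k - 1, by omega⟩
  refine ⟨(k + 1 : ℕ), ?_⟩
  rw [zpow_natCast, pow_succ', Perm.mul_apply,
    mul_pow_apply_of_avoids hκ fun i hi hi' => hk' i hi (by omega), Perm.mul_apply,
    ← Perm.mul_apply f, ← pow_succ']

/-- Walk back from `d` to the nearest point of `O`; the path from there to `d` is the same for both
permutations. -/
lemma exists_anchor [Finite D] (hκ : ∀ x ∉ O, κ x = x) {s d : D} (hs : s ∈ O)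
    (h : f.SameCycle s d) : ∃ s' ∈ O, f.SameCycle s' d ∧ (κ * f).SameCycle s' d := by
  obtain ⟨s', hs', k, hk, hk'⟩ := exists_path_from_set hs h
  exact ⟨s', hs', ⟨k, by simpa using hk⟩,
    ⟨k, by rw [zpow_natCast, mul_pow_apply_of_avoids hκ hk', hk]⟩⟩

lemma sameCycle_mul_of_avoids [Finite D] (hκ : ∀ x ∉ O, κ x = x) {d d' : D}
    (hd : ∀ s ∈ O, ¬ f.SameCycle s d) (h : f.SameCycle d d') : (κ * f).SameCycle d d' := by
  obtain ⟨k, -, rfl⟩ := h.exists_pow_eq'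
  refine ⟨k, ?_⟩
  rw [zpow_natCast, mul_pow_apply_of_avoids hκ]
  intro i _ _ hi
  exact hd _ hi (SameCycle.symm ⟨i, by simp⟩)

/-- Modifying `f` on `O` preserves cycles if it does so for the points of `O`. -/
lemma SameCycle.mul_of_forall [Finite D] (hκ : ∀ x ∉ O, κ x = x)
    (hO : ∀ s ∈ O, ∀ t ∈ O, f.SameCycle s t → (κ * f).SameCycle s t) {d d' : D}
    (h : f.SameCycle d d') : (κ * f).SameCycle d d' := by
  by_cases hd : ∃ s ∈ O, f.SameCycle s d
  · obtain ⟨s, hs, hsd⟩ := hd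
    obtain ⟨s₁, hs₁, h₁, h₁'⟩ := exists_anchor hκ hs hsd
    obtain ⟨s₂, hs₂, h₂, h₂'⟩ := exists_anchor hκ hs (hsd.trans h)
    exact h₁'.symm.trans ((hO _ hs₁ _ hs₂ (h₁.trans (h.trans h₂.symm))).trans h₂')
  · push Not at hd
    exact sameCycle_mul_of_avoids hκ hd h

end Modify

/-! ### Transpositions merge or split cycles -/

section Swap

variable [DecidableEq D] {f : Perm D} {a b : D}

lemma swap_eq_self_off (a b : D) : ∀ x ∉ ({a, b} : Set D), swap a b x = x := by
  intro x hx
  simp only [Set.mem_insert_iff, Set.mem_singleton_iff, not_or] at hx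
  exact swap_apply_of_ne_of_ne hx.1 hx.2

variable [Finite D]

lemma SameCycle.swap_mul (hab : ¬ f.SameCycle a b) {d d' : D} (h : f.SameCycle d d') :
    (swap a b * f).SameCycle d d' := by
  refine h.mul_of_forall (swap_eq_self_off a b) ?_
  rintro s (rfl | rfl) t (rfl | rfl) hst
  · exact .rfl
  · exact absurd hst hab
  · exact absurd hst.symm hab
  · exact .rfl

/-- The cycle of `a` misses `b`, so `a` first returns to `a`, and this return is diverted to `b`. -/
lemma sameCycle_swap_mul (hab : ¬ f.SameCycle a b) : (swap a b * f).SameCycle a b := by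
  obtain ⟨t, ht⟩ := exists_firstReturn f (O := {a, b}) (s := a) (by simp)
  have h := ht.sameCycle_mul (swap_eq_self_off a b)
  rcases ht.1 with rfl | rfl
  · simpa using h
  · exact absurd ht.sameCycle hab

lemma sameCycle_or_of_swap_mul (hf : ∀ d d', f.SameCycle d d') (d : D) :
    (swap a b * f).SameCycle a d ∨ (swap a b * f).SameCycle b d := by
  obtain ⟨s, rfl | rfl, -, h⟩ :=
    exists_anchor (O := {a, b}) (swap_eq_self_off a b) (by simp) (hf a d)
  · exact .inl h
  · exact .inr h

/-- The path from `a` to `b` is cut at its end and diverted to `a`, closing up a cycle that omits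
`b`. -/
lemma not_sameCycle_swap_mul (hne : a ≠ b) (hab : f.SameCycle a b) :
    ¬ (swap a b * f).SameCycle a b := by
  -- A return to `a` before `b` would make `{a}` closed under first returns, and `b` would not be on
  -- the cycle.
  have key : f.FirstReturn {a, b} a b := by
    obtain ⟨t, ht⟩ := exists_firstReturn f (O := {a, b}) (s := a) (by simp)
    rcases ht.1 with rfl | rfl
    · refine absurd (mem_of_firstReturn_closed (P := {t}) (O := {t, b}) (f := f) ?_ rfl (by simp)
        hab) (by simpa using hne.symm)
      rintro s rfl u hu
      exact hu.unique ht
    · exact ht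
  intro h
  obtain ⟨-, k, hk, hkb, hk'⟩ := key
  obtain ⟨l, rfl⟩ : ∃ l, k = l + 1 := ⟨k - 1, by omega⟩
  have hk'' := fun i hi hi' => hk' i hi (Nat.lt_succ_of_le hi')
  have hper : ((swap a b * f) ^ (l + 1)) a = a := by
    rw [pow_succ', Perm.mul_apply, mul_pow_apply_of_avoids (swap_eq_self_off a b) hk'',
      Perm.mul_apply, ← Perm.mul_apply f, ← pow_succ', hkb, swap_apply_right]
  obtain ⟨n, -, hn⟩ := h.exists_pow_eq'
  have hpow : ∀ j : ℕ, (((swap a b * f) ^ (l + 1)) ^ j) a = a := by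
    intro j
    induction j with
    | zero => simp
    | succ j ih => rw [pow_succ', Perm.mul_apply, ih, hper]
  have hmod : ((swap a b * f) ^ (n % (l + 1))) a = b := by
    rw [← Nat.mod_add_div n (l + 1), pow_add, pow_mul, Perm.mul_apply, hpow] at hn
    exact hn
  have hlt : n % (l + 1) < l + 1 := Nat.mod_lt n (Nat.succ_pos l)
  rw [mul_pow_apply_of_avoids (swap_eq_self_off a b) fun i hi hi' => hk'' i hi (by omega)] at hmod
  rcases Nat.eq_zero_or_pos (n % (l + 1)) with h0 | h0
  · rw [h0] at hmod
    exact hne (by simpa using hmod)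
  · exact hk'' _ h0 (by omega) (by rw [hmod]; simp)

end Swap

/-! ### Cyclic orders of three points -/

section Three

variable [Finite D] {f : Perm D} {a b c : D}

/-- Three points on a cycle occur in one of the two cyclic orders. -/
lemma firstReturn_three (hab : a ≠ b) (hac : a ≠ c) (hbc : b ≠ c)
    (h₁ : f.SameCycle a b) (h₂ : f.SameCycle a c) :
    (f.FirstReturn {a, b, c} a b ∧ f.FirstReturn {a, b, c} b c ∧ f.FirstReturn {a, b, c} c a) ∨
    (f.FirstReturn {a, b, c} a c ∧ f.FirstReturn {a, b, c} c b ∧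
      f.FirstReturn {a, b, c} b a) := by
  set O : Set D := {a, b, c} with hO
  obtain ⟨a', ha'⟩ := exists_firstReturn f (O := O) (s := a) (by simp [hO])
  obtain ⟨b', hb'⟩ := exists_firstReturn f (O := O) (s := b) (by simp [hO])
  obtain ⟨c', hc'⟩ := exists_firstReturn f (O := O) (s := c) (by simp [hO])
  have one : ∀ s t, s ∈ O → t ∈ O → s ≠ t → f.SameCycle s t → ¬ f.FirstReturn O s s := by
    intro s t hs ht hne hst hss
    refine hne.symm (mem_of_firstReturn_closed (P := {s}) (O := O) (f := f) ?_ rfl ht hst)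
    rintro _ rfl u hu
    exact hu.unique hss
  -- Two points that return to each other absorb the cycle and leave no room for a third.
  have two : ∀ s t u, u ∈ O → s ≠ u → t ≠ u → f.SameCycle s u →
      f.FirstReturn O s t → f.FirstReturn O t s → False := by
    intro s t u hu hsu htu hc hst hts
    have := mem_of_firstReturn_closed (P := {s, t}) (O := O) (f := f) ?_ (Or.inl rfl) hu hc
    · rcases this with h | h
      · exact hsu h.symm
      · exact htu h.symm
    · rintro _ (rfl | rfl) v hv
      · exact .inr (hv.unique hst)
      · exact .inl (hv.unique hts)
  have ha : a ∈ O := by simp [hO]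
  have hb : b ∈ O := by simp [hO]
  have hc : c ∈ O := by simp [hO]
  have hbc' := h₁.symm.trans h₂
  rcases ha'.1 with rfl | rfl | rfl
  · exact absurd ha' (one _ _ ha hb hab h₁)
  · rcases hb'.1 with rfl | rfl | rfl
    · exact (two _ _ _ hc hac hbc h₂ ha' hb').elim
    · exact absurd hb' (one _ _ hb hc hbc hbc')
    · rcases hc'.1 with rfl | rfl | rfl
      · exact .inl ⟨ha', hb', hc'⟩
      · exact (two _ _ _ ha hab.symm hac.symm h₁.symm hb' hc').elim
      · exact absurd hc' (one _ _ hc hb hbc.symm hbc'.symm)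
  · rcases hc'.1 with rfl | rfl | rfl
    · exact (two _ _ _ hb hab hbc.symm h₁ ha' hc').elim
    · rcases hb'.1 with rfl | rfl | rfl
      · exact .inr ⟨ha', hc', hb'⟩
      · exact absurd hb' (one _ _ hb hc hbc hbc')
      · exact (two _ _ _ ha hac.symm hab.symm h₂.symm hc' hb').elim
    · exact absurd hc' (one _ _ hc hb hbc.symm hbc'.symm)

/-- On the three points the first return map is the 3-cycle (a b c), and after the modification its
square (a c b), again a single cycle. -/
lemma SameCycle.mul_three {κ : Perm D} (h₁ : f.FirstReturn {a, b, c} a b)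
    (h₂ : f.FirstReturn {a, b, c} b c) (h₃ : f.FirstReturn {a, b, c} c a)
    (hκ : ∀ x ∉ ({a, b, c} : Set D), κ x = x) (ha : κ a = b) (hb : κ b = c) (hc : κ c = a)
    {d d' : D} (h : f.SameCycle d d') : (κ * f).SameCycle d d' := by
  have e₁ := h₁.sameCycle_mul hκ
  have e₂ := h₂.sameCycle_mul hκ
  have e₃ := h₃.sameCycle_mul hκ
  rw [hb] at e₁
  rw [hc] at e₂
  rw [ha] at e₃
  have all : ∀ s ∈ ({a, b, c} : Set D), (κ * f).SameCycle a s := by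
    rintro s (rfl | rfl | rfl)
    · exact .rfl
    · exact e₂.symm
    · exact e₁
  exact h.mul_of_forall hκ fun s hs t ht _ => (all s hs).symm.trans (all t ht)

end Three

/-! ### Rotations that agree with the order along the face -/

section Separate

variable {ρ ν : Perm D}

/-- If `ν` is the first return map of `ν * ρ` on each of its own cycles, then the segment of
`ν * ρ` from `a` to `ρ a` is invariant under `ρ`. -/
lemma segment_invariant (hρ : ∀ d, ρ (ρ d) = d)
    (hF : ∀ a, (ν * ρ).FirstReturn {d | ν.SameCycle a d} a (ν a)) :
    ∀ (k : ℕ) (a : D), ((ν * ρ) ^ k) a = ρ a →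
      (∀ i, 0 < i → i ≤ k → ¬ ν.SameCycle a (((ν * ρ) ^ i) a)) →
      ∀ i ≤ k, ∃ j ≤ k, ρ (((ν * ρ) ^ i) a) = ((ν * ρ) ^ j) a := by
  classical
  set φ := ν * ρ with hφ
  -- Since `φ (ρ c) = ν c`, the orbit of `c` passes through `ρ c` just before its first return `ν
  -- c`.
  have hk : ∀ c, ∃ k, (φ ^ k) c = ρ c ∧ ∀ i, 0 < i → i ≤ k → ¬ ν.SameCycle c ((φ ^ i) c) := by
    intro c
    obtain ⟨-, k, hk, hkc, hk'⟩ := hF c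
    obtain ⟨l, rfl⟩ : ∃ l, k = l + 1 := ⟨k - 1, by omega⟩
    refine ⟨l, ?_, fun i hi hi' => hk' i hi (by omega)⟩
    rw [pow_succ', Perm.mul_apply] at hkc
    have : φ (ρ c) = ν c := by rw [hφ, Perm.mul_apply, hρ]
    exact φ.injective (hkc.trans this.symm)
  intro k
  induction k using Nat.strong_induction_on with
  | _ k ih =>
    intro a hka hav i hik
    rcases Nat.eq_zero_or_pos i with rfl | hi
    · exact ⟨k, le_rfl, by simpa using hka.symm⟩
    -- the last visit to the cycle of `ρ a` not after the time `i`
    have h1 : ν.SameCycle (ρ a) ((φ ^ 1) a) := by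
      rw [pow_one, hφ, Perm.mul_apply]
      exact sameCycle_apply_right.2 .rfl
    set P : ℕ → Prop := fun j => 0 < j ∧ ν.SameCycle (ρ a) ((φ ^ j) a) with hP
    have hspec : P (Nat.findGreatest P i) := Nat.findGreatest_spec (P := P) hi ⟨one_pos, h1⟩
    have hle : Nat.findGreatest P i ≤ i := Nat.findGreatest_le i
    set j := Nat.findGreatest P i with hj
    rcases (hle.trans hik).eq_or_lt with hjk | hjk
    · have : i = k := by omega
      exact ⟨0, by omega, by rw [this, hka, hρ]; simp⟩
    -- Restart at the last visit `j`: the segment from there to its own reversal is shorter and, as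
    -- the next two claims show, contains the time `i`.
    obtain ⟨l, hl, hl'⟩ := hk ((φ ^ j) a)
    have hka' : (φ ^ (k - j)) ((φ ^ j) a) = ρ a := by
      rw [← Perm.mul_apply, ← pow_add, Nat.sub_add_cancel hjk.le, hka]
    have hlk : l < k - j := by
      by_contra hlt
      refine hl' (k - j) (by omega) (by omega) ?_
      rw [hka']
      exact hspec.2.symm
    -- One step after that segment the orbit is at `ν (φ^j a)`, a later visit to the same cycle of
    -- ν, against the choice of `j`.
    have hij : i - j ≤ l := by
      by_contra hlt
      have hgr := Nat.findGreatest_is_greatest (P := P) (n := i) (k := j + (l + 1)) (by omega)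
        (by omega)
      refine hgr ⟨by omega, ?_⟩
      rw [add_comm j, pow_add, Perm.mul_apply, pow_succ', Perm.mul_apply, hl, hφ, Perm.mul_apply,
        hρ]
      exact sameCycle_apply_right.2 hspec.2
    obtain ⟨m, hm, hm'⟩ := ih l (by omega) _ hl hl' (i - j) hij
    refine ⟨m + j, by omega, ?_⟩
    rw [pow_add, Perm.mul_apply, ← hm', ← Perm.mul_apply (φ ^ (i - j)), ← pow_add,
      Nat.sub_add_cancel hle]

/-- `S` is the face segment after `a` up to `ρ a`. It is a union of cycles of ν, and apart from `ρ
a` it is closed under reversal: the edge of `a` is the only one that leaves it. This is what makes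
that edge a bridge. -/
lemma exists_separating_set [Finite D] (hρ : ∀ d, ρ (ρ d) = d) (hne : ∀ d, ρ d ≠ d)
    (hF : ∀ a, (ν * ρ).FirstReturn {d | ν.SameCycle a d} a (ν a)) (a : D) :
    ∃ S : Set D, a ∉ S ∧ ρ a ∈ S ∧ (∀ d ∈ S, ∀ d', ν.SameCycle d d' → d' ∈ S) ∧
      ∀ d ∈ S, d ≠ ρ a → ρ d ∈ S := by
  obtain ⟨-, k, hk, hkc, hk'⟩ := hF a
  obtain ⟨l, rfl⟩ : ∃ l, k = l + 1 := ⟨k - 1, by omega⟩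
  have hl : ((ν * ρ) ^ l) a = ρ a := by
    rw [pow_succ', Perm.mul_apply] at hkc
    have : (ν * ρ) (ρ a) = ν a := by rw [Perm.mul_apply, hρ]
    exact (ν * ρ).injective (hkc.trans this.symm)
  have hl' : ∀ i, 0 < i → i ≤ l → ¬ ν.SameCycle a (((ν * ρ) ^ i) a) :=
    fun i hi hi' => hk' i hi (by omega)
  have hseg := segment_invariant hρ hF l a hl hl'
  have hl0 : 0 < l := by
    rcases Nat.eq_zero_or_pos l with rfl | h
    · exact absurd hl.symm (by simpa using hne a)
    · exact h
  set S : Set D := {d | ∃ i, 0 < i ∧ i ≤ l ∧ ((ν * ρ) ^ i) a = d} with hS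
  have haS : a ∉ S := by
    rintro ⟨i, hi, hi', h⟩
    exact hl' i hi hi' (by rw [h])
  have hρS : ∀ d ∈ S, d ≠ ρ a → ρ d ∈ S := by
    rintro _ ⟨i, hi, hi', rfl⟩ hd
    obtain ⟨j, hj, hj'⟩ := hseg i hi'
    rcases Nat.eq_zero_or_pos j with rfl | hjpos
    · refine absurd ?_ hd
      have := congrArg ρ hj'
      simpa [hρ] using this
    · exact ⟨j, hjpos, hj, hj'.symm⟩
  -- To apply ν to `d`, reverse `d` within the segment and move one step ahead; the step never
  -- leaves the segment, since its end `ρ a` is the reversal of `a`, which is not in `S`.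
  have hνS : ∀ d ∈ S, ν d ∈ S := by
    intro d hd
    by_cases hda : d = ρ a
    · refine ⟨1, one_pos, hl0, ?_⟩
      rw [hda, pow_one, Perm.mul_apply]
    · obtain ⟨i, hi, hi', h⟩ := hρS d hd hda
      rcases hi'.eq_or_lt with rfl | hlt
      · refine absurd ?_ haS
        have : d = a := ρ.injective (h.symm.trans hl)
        rwa [← this]
      · refine ⟨i + 1, by omega, hlt, ?_⟩
        rw [pow_succ', Perm.mul_apply, h, Perm.mul_apply, hρ]
  refine ⟨S, haS, ⟨l, hl0, le_rfl, hl⟩, ?_, hρS⟩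
  intro d hd d' hdd'
  obtain ⟨i, -, rfl⟩ := hdd'.exists_pow_eq'
  clear hdd'
  induction i with
  | zero => simpa
  | succ i ih =>
    rw [pow_succ', Perm.mul_apply]
    exact hνS _ ih

end Separate

/-! ### Partially assembled rotation systems -/

section Glued

variable {α : Type*}

/-- The cycles of `ν` are the fibres of `τ` within `Q`, and single points outside `Q`. -/
def Glued (τ : D → α) (Q : Set D) (ν : Perm D) : Prop :=
  ∀ d d', ν.SameCycle d d' ↔ d = d' ∨ (τ d = τ d' ∧ d ∈ Q ∧ d' ∈ Q)

variable {τ : D → α} {Q : Set D} {ν : Perm D}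

lemma Glued.one (τ : D → α) : Glued τ ∅ (1 : Perm D) := by
  intro d d'
  simp

lemma Glued.apply_eq_self (h : Glued τ Q ν) {d : D} (hd : d ∉ Q) : ν d = d := by
  have := (h d (ν d)).1 (sameCycle_apply_right.2 .rfl)
  rcases this with h | h
  · exact h.symm
  · exact absurd h.2.1 hd

lemma Glued.apply (h : Glued τ Q ν) (d : D) : τ (ν d) = τ d := by
  have := (h d (ν d)).1 (sameCycle_apply_right.2 .rfl)
  rcases this with h | h
  · rw [← h]
  · exact h.1.symm

lemma Glued.apply_mem (h : Glued τ Q ν) {d : D} (hd : d ∈ Q) : ν d ∈ Q := by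
  have := (h d (ν d)).1 (sameCycle_apply_right.2 .rfl)
  rcases this with h | h
  · rwa [← h]
  · exact h.2.2

/-- A dart of a vertex without glued darts may be counted as glued. -/
lemma Glued.insert_free (h : Glued τ Q ν) {a : D} (ha : ∀ d ∈ Q, τ d ≠ τ a) :
    Glued τ (insert a Q) ν := by
  intro d d'
  rw [h d d']
  constructor
  · rintro (h | ⟨h, h', h''⟩)
    · exact .inl h
    · exact .inr ⟨h, .inr h', .inr h''⟩
  · rintro (h | ⟨h, rfl | h', rfl | h''⟩)
    · exact .inl h
    · exact .inl rfl
    · exact absurd h.symm (ha _ h'')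
    · exact absurd h (ha _ h')
    · exact .inr ⟨h, h', h''⟩

lemma Glued.equivalence (τ : D → α) (Q : Set D) :
    Equivalence fun d d' : D => d = d' ∨ (τ d = τ d' ∧ d ∈ Q ∧ d' ∈ Q) where
  refl _ := .inl rfl
  symm := by
    rintro d d' (h | ⟨h, h', h''⟩)
    · exact .inl h.symm
    · exact .inr ⟨h.symm, h'', h'⟩
  trans := by
    rintro d d' d'' (rfl | ⟨h, h', h''⟩) (rfl | ⟨k, k', k''⟩)
    · exact .inl rfl
    · exact .inr ⟨k, k', k''⟩
    · exact .inr ⟨h, h', h''⟩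
    · exact .inr ⟨h.trans k, h', k''⟩

/-- A dangling dart is a cycle of its own, and the transposition merges it with the cycle of a glued
dart of its vertex. -/
lemma Glued.insert_swap [DecidableEq D] [Finite D] (h : Glued τ Q ν) {a b : D} (ha : a ∈ Q)
    (hb : b ∉ Q) (hab : τ a = τ b) : Glued τ (insert b Q) (swap a b * ν) := by
  have hns : ¬ ν.SameCycle a b := by
    rw [h a b]
    rintro (rfl | h)
    · exact hb ha
    · exact hb h.2.2
  intro d d'
  constructor
  · refine fun hd => SameCycle.rel (Glued.equivalence τ (insert b Q)) ?_ hd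
    intro d
    refine (Glued.equivalence τ (insert b Q)).trans (y := ν d) ?_ ?_
    · rcases (h d (ν d)).1 (sameCycle_apply_right.2 .rfl) with h | ⟨h, h', h''⟩
      · exact .inl h
      · exact .inr ⟨h, .inr h', .inr h''⟩
    · rw [Perm.mul_apply]
      by_cases h1 : ν d = a
      · rw [h1, swap_apply_left]
        exact .inr ⟨hab, .inr ha, .inl rfl⟩
      by_cases h2 : ν d = b
      · rw [h2, swap_apply_right]
        exact .inr ⟨hab.symm, .inl rfl, .inr ha⟩
      rw [swap_apply_of_ne_of_ne h1 h2]
      exact .inl rfl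
  · have key : ∀ d ∈ insert b Q, τ d = τ a → (swap a b * ν).SameCycle a d := by
      rintro d (rfl | hd) hda
      · exact sameCycle_swap_mul hns
      · exact SameCycle.swap_mul hns ((h a d).2 (.inr ⟨hda.symm, ha, hd⟩))
    rintro (rfl | ⟨h1, h2, h3⟩)
    · exact .rfl
    by_cases hda : τ d = τ a
    · exact (key d h2 hda).symm.trans (key d' h3 (h1.symm.trans hda))
    · have hdb : d ≠ b := fun h' => hda (h' ▸ hab.symm)
      have hdb' : d' ≠ b := fun h' => hda (h1.trans (h' ▸ hab.symm))
      exact SameCycle.swap_mul hns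
        ((h d d').2 (.inr ⟨h1, h2.resolve_left hdb, h3.resolve_left hdb'⟩))

/-- On the darts of `v` the factor κ inverts ν, so that they become fixed points. -/
lemma Glued.unglue [Finite D] (h : Glued τ Q ν) {κ : Perm D} {O : Set D} {v : α}
    (hO : O = {d | τ d = v}) (hκ : ∀ x ∉ O, κ x = x) (hκO : ∀ x ∈ O, κ (ν x) = x) :
    Glued τ (Q \ O) (κ * ν) := by
  have hνO : ∀ x ∉ O, ν x ∉ O := by
    intro x hx hx'
    rw [hO, Set.mem_ofPred_eq] at hx hx'
    exact hx (by rw [← h.apply x, hx'])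
  intro d d'
  constructor
  · refine fun hd => SameCycle.rel (Glued.equivalence τ (Q \ O)) ?_ hd
    intro d
    rw [Perm.mul_apply]
    by_cases hd : d ∈ O
    · exact .inl (hκO d hd).symm
    rw [hκ _ (hνO d hd)]
    rcases (h d (ν d)).1 (sameCycle_apply_right.2 .rfl) with h' | ⟨h', h'', h'''⟩
    · exact .inl h'
    · exact .inr ⟨h', ⟨h'', hd⟩, h''', hνO d hd⟩
  · rintro (rfl | ⟨h1, h2, h3⟩)
    · exact .rfl
    refine sameCycle_mul_of_avoids hκ ?_ ((h d d').2 (.inr ⟨h1, h2.1, h3.1⟩))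
    intro s hs hsd
    rcases (h s d).1 hsd with rfl | h'
    · exact h2.2 hs
    · refine h2.2 ?_
      rw [hO, Set.mem_ofPred_eq] at hs ⊢
      rw [← hs, h'.1]

end Glued

end Equiv.Perm

/-! ### The sign of a permutation and its number of cycles -/

namespace Equiv.Perm

section Sign

variable {D : Type*}

lemma card_quotient_swap_mul [DecidableEq D] [Finite D] {f : Perm D} {a b : D}
    (hab : ¬ f.SameCycle a b) :
    Nat.card (Quotient (SameCycle.setoid f)) =
      Nat.card (Quotient (SameCycle.setoid (swap a b * f))) + 1 := by
  classical
  -- Moving the cycle of `b` to `a` makes `p` constant, up to cycles of `f`, on the cycles of the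
  -- product; this gives injectivity once the class of `b` is left out.
  set p : D → D := fun d => if f.SameCycle d b then a else d with hp
  have hpp : ∀ d, ¬ f.SameCycle d b → p d = d := fun d hd => if_neg hd
  have hpb : p b = a := if_pos .rfl
  have hrel : ∀ d d', (swap a b * f).SameCycle d d' → f.SameCycle (p d) (p d') := by
    intro d d' h
    refine SameCycle.rel (R := fun d d' => f.SameCycle (p d) (p d'))
      ⟨fun _ => .rfl, SameCycle.symm, SameCycle.trans⟩ ?_ h
    intro d
    have h1 : f.SameCycle (p d) (p (f d)) := by
      simp only [hp, sameCycle_apply_left]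
      split_ifs
      · exact .rfl
      · exact sameCycle_apply_right.2 .rfl
    refine h1.trans ?_
    rw [Perm.mul_apply]
    by_cases ha : f d = a
    · rw [ha, swap_apply_left, hpp a hab, hpb]
    by_cases hb : f d = b
    · rw [hb, swap_apply_right, hpp a hab, hpb]
    rw [swap_apply_of_ne_of_ne ha hb]
  let F : {q : Quotient (SameCycle.setoid f) // q ≠ Quotient.mk _ b} →
      Quotient (SameCycle.setoid (swap a b * f)) :=
    fun q => Quotient.map' id (fun _ _ h => SameCycle.swap_mul hab h) q.1
  have hF : Function.Bijective F := by
    constructor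
    · rintro ⟨q, hq⟩ ⟨q', hq'⟩ h
      induction q using Quotient.inductionOn with
      | _ d =>
      induction q' using Quotient.inductionOn with
      | _ d' =>
      have h' : (swap a b * f).SameCycle d d' := Quotient.exact h
      have hd : ¬ f.SameCycle d b := fun h => hq (Quotient.sound h)
      have hd' : ¬ f.SameCycle d' b := fun h => hq' (Quotient.sound h)
      have := hrel d d' h'
      rw [hpp _ hd, hpp _ hd'] at this
      exact Subtype.ext (Quotient.sound this)
    · intro q
      induction q using Quotient.inductionOn with
      | _ d =>
      by_cases hd : f.SameCycle d b
      · refine ⟨⟨Quotient.mk _ a, fun h => hab (Quotient.exact h)⟩, Quotient.sound ?_⟩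
        exact (sameCycle_swap_mul hab).trans (SameCycle.swap_mul hab hd).symm
      · exact ⟨⟨Quotient.mk _ d, fun h => hd (Quotient.exact h)⟩, rfl⟩
  rw [← Nat.card_congr (Equiv.ofBijective F hF)]
  have h1 : Nat.card {q : Quotient (SameCycle.setoid f) // q ≠ Quotient.mk _ b} =
      ({Quotient.mk _ b}ᶜ : Set (Quotient (SameCycle.setoid f))).ncard := rfl
  have h2 := Set.ncard_add_ncard_compl ({Quotient.mk _ b} : Set (Quotient (SameCycle.setoid f)))
  rw [Set.ncard_singleton] at h2
  omega

lemma sign_eq_neg_one_pow_card_quotient [DecidableEq D] [Fintype D] (f : Perm D) :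
    sign f = (-1) ^ (Nat.card D + Nat.card (Quotient (SameCycle.setoid f))) := by
  induction f using swap_induction_on with
  | one =>
    have : Nat.card (Quotient (SameCycle.setoid (1 : Perm D))) = Nat.card D := by
      refine (Nat.card_congr (Equiv.ofBijective
        (fun d => (Quotient.mk (SameCycle.setoid (1 : Perm D)) d)) ⟨?_, ?_⟩)).symm
      · intro d d' h
        exact sameCycle_one.1 (Quotient.exact h)
      · exact Quotient.mk_surjective
    rw [this, ← two_mul, pow_mul]
    simp
  | swap_mul f a b hab ih =>
    rw [sign_mul, sign_swap hab, ih]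
    by_cases h : f.SameCycle a b
    · have := card_quotient_swap_mul (not_sameCycle_swap_mul hab h)
      rw [swap_mul_self_mul] at this
      rw [this, ← add_assoc, pow_succ]
      simp
    · rw [card_quotient_swap_mul h, ← add_assoc, pow_succ]
      simp

end Sign

end Equiv.Perm

/-! ### Darts, degrees and the parity of the number of faces -/

namespace Graph

variable {α β : Type*} {G : Graph α β}

/-- `t` assigns to each dart the vertex that it leaves. -/
def IsTail (G : Graph α β) (t : G.DartType → α) : Prop :=
  ∀ e : G.edgeSet, G.IsLink e.1 (t (e, false)) (t (e, true))

lemma exists_isTail (G : Graph α β) : ∃ t : G.DartType → α, G.IsTail t := by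
  have : ∀ e : G.edgeSet, ∃ x y, G.IsLink e.1 x y := fun e => exists_isLink_of_mem_edgeSet e.2
  choose x y h using this
  exact ⟨fun d => if d.2 then y d.1 else x d.1, fun e => by simpa using h e⟩

@[simp]
lemma dartRev_apply (d : G.DartType) : G.dartRev d = (d.1, !d.2) := rfl

lemma dartRev_dartRev (d : G.DartType) : G.dartRev (G.dartRev d) = d := by
  obtain ⟨e, b⟩ := d
  simp

lemma dartRev_ne (d : G.DartType) : G.dartRev d ≠ d := by
  obtain ⟨e, b⟩ := d
  cases b <;> simp

lemma eq_or_eq_dartRev {d d' : G.DartType} (h : d.1 = d'.1) : d = d' ∨ d = G.dartRev d' := by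
  obtain ⟨e, b⟩ := d
  obtain ⟨e', b'⟩ := d'
  obtain rfl : e = e' := h
  cases b <;> cases b' <;> simp

lemma IsTail.isLink {t : G.DartType → α} (ht : G.IsTail t) (d : G.DartType) :
    G.IsLink d.1 (t d) (t (G.dartRev d)) := by
  obtain ⟨e, b⟩ := d
  cases b
  · exact ht e
  · exact (ht e).symm

lemma IsTail.exists_dart {t : G.DartType → α} (ht : G.IsTail t) {e : β} {x y : α}
    (h : G.IsLink e x y) : ∃ d : G.DartType, d.1.1 = e ∧ t d = x ∧ t (G.dartRev d) = y := by
  rcases (ht ⟨e, h.edge_mem⟩).eq_and_eq_or_eq_and_eq h with ⟨h1, h2⟩ | ⟨h1, h2⟩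
  · exact ⟨(⟨e, h.edge_mem⟩, false), rfl, h1, h2⟩
  · exact ⟨(⟨e, h.edge_mem⟩, true), rfl, h2, h1⟩

lemma IsTail.mem {t : G.DartType → α} (ht : G.IsTail t) (d : G.DartType) : t d ∈ G.vertexSet :=
  (ht.isLink d).left_mem

/-- The degree of a vertex is the number of darts that leave it. -/
lemma vertexDegree_eq_ncard {t : G.DartType → α} (ht : G.IsTail t) (hE : G.edgeSet.Finite)
    (v : α) : G.vertexDegree v = {d | t d = v}.ncard := by
  have := hE.to_subtype
  set S₀ : Set G.edgeSet := {e | t (e, false) = v} with hS₀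
  set S₁ : Set G.edgeSet := {e | t (e, true) = v} with hS₁
  have hd : {d | t d = v} = (fun e => (e, false)) '' S₀ ∪ (fun e => (e, true)) '' S₁ := by
    ext ⟨e, b⟩
    cases b <;> simp [hS₀, hS₁]
  have hdisj : Disjoint ((fun e : G.edgeSet => (e, false)) '' S₀)
      ((fun e : G.edgeSet => (e, true)) '' S₁) := by
    rw [Set.disjoint_left]
    rintro _ ⟨e, -, rfl⟩ ⟨e', -, h⟩
    simp at h
  rw [hd, Set.ncard_union_eq hdisj,
    Set.ncard_image_of_injective _ (fun a b h => (Prod.ext_iff.1 h).1),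
    Set.ncard_image_of_injective _ (fun a b h => (Prod.ext_iff.1 h).1),
    ← Set.ncard_union_add_ncard_inter S₀ S₁]
  have hL : {e | G.IsLoopAt e v} = Subtype.val '' (S₀ ∩ S₁) := by
    ext e
    constructor
    · intro h
      refine ⟨⟨e, h.edge_mem⟩, ?_, rfl⟩
      rcases (ht ⟨e, h.edge_mem⟩).eq_and_eq_or_eq_and_eq h with ⟨h1, h2⟩ | ⟨h1, h2⟩ <;>
        exact ⟨h1, h2⟩
    · rintro ⟨e, ⟨h1, h2⟩, rfl⟩
      have := ht e
      rw [show t (e, false) = v from h1, show t (e, true) = v from h2] at this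
      exact this
  have hN : {e | G.IsNonloopAt e v} = Subtype.val '' (S₀ ∪ S₁) \ Subtype.val '' (S₀ ∩ S₁) := by
    rw [← hL]
    ext e
    rw [Set.mem_ofPred_eq, isNonloopAt_iff_inc_not_isLoopAt]
    refine and_congr ?_ Iff.rfl
    constructor
    · rintro ⟨y, h⟩
      refine ⟨⟨e, h.edge_mem⟩, ?_, rfl⟩
      rcases (ht ⟨e, h.edge_mem⟩).eq_and_eq_or_eq_and_eq h with ⟨h1, h2⟩ | ⟨h1, h2⟩
      · exact .inl h1
      · exact .inr h2
    · rintro ⟨e, h | h, rfl⟩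
      · exact ⟨_, h ▸ ht e⟩
      · exact ⟨_, h ▸ (ht e).symm⟩
  rw [vertexDegree, hN, hL, Set.ncard_sdiff (Set.image_mono
    (Set.inter_subset_left.trans Set.subset_union_left)),
    Set.ncard_image_of_injective _ Subtype.val_injective,
    Set.ncard_image_of_injective _ Subtype.val_injective]
  have : (S₀ ∩ S₁).ncard ≤ (S₀ ∪ S₁).ncard :=
    Set.ncard_le_ncard (Set.inter_subset_left.trans Set.subset_union_left)
  omega

lemma card_dartType (G : Graph α β) : Nat.card G.DartType = 2 * G.edgeSet.ncard := by
  rw [Nat.card_prod, mul_comm, Nat.card_coe_set_eq]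
  simp

lemma IsCubicGraph.three_mul_ncard (h : G.IsCubicGraph) (hV : G.vertexSet.Finite)
    (hE : G.edgeSet.Finite) : 3 * G.vertexSet.ncard = 2 * G.edgeSet.ncard := by
  classical
  have := hE.to_subtype
  have := Fintype.ofFinite G.DartType
  obtain ⟨t, ht⟩ := G.exists_isTail
  rw [← card_dartType, Nat.card_eq_fintype_card, ← Finset.card_univ,
    Finset.card_eq_sum_card_fiberwise (t := hV.toFinset) (f := t)
      (fun d _ => by simpa using ht.mem d), Finset.sum_const_nat (m := 3), mul_comm,
    Set.ncard_eq_toFinset_card _ hV]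
  intro v hv
  rw [← h v (by simpa using hv), vertexDegree_eq_ncard ht hE, Set.ncard_eq_toFinset_card']
  congr 1
  ext d
  simp

namespace RotationSystem

variable (R : G.RotationSystem)

lemma isTail : G.IsTail R.tail := R.isLink

/-- Compare signs in `facePerm = next * dartRev`: the sign of a permutation counts its cycles modulo
2, `next` has one cycle per nonisolated vertex, and `dartRev` consists of one transposition per
edge. Isolated vertices count both as vertices and as faces. -/
lemma even_numFaces (hV : G.vertexSet.Finite) (hE : G.edgeSet.Finite) :
    Even (R.numFaces + G.vertexSet.ncard + G.edgeSet.ncard) := by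
  classical
  have := hE.to_subtype
  have := Fintype.ofFinite G.edgeSet
  have hrev : Equiv.Perm.sign G.dartRev = (-1) ^ G.edgeSet.ncard := by
    have : G.dartRev = Equiv.prodCongrRight fun _ : G.edgeSet => Equiv.boolNot := by
      ext d <;> rfl
    rw [this, Equiv.Perm.sign_prodCongrRight, Finset.prod_const,
      show Equiv.Perm.sign Equiv.boolNot = -1 by decide, Finset.card_univ,
      ← Nat.card_eq_fintype_card, Nat.card_coe_set_eq]
  have hnext : Nat.card (Quotient (Equiv.Perm.SameCycle.setoid R.next)) =
      (Set.range R.tail).ncard := by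
    rw [← Nat.card_coe_set_eq]
    refine Nat.card_congr (Equiv.ofBijective (fun q => Quotient.liftOn q
      (fun d => (⟨R.tail d, d, rfl⟩ : Set.range R.tail)) ?_) ⟨?_, ?_⟩)
    · intro d d' h
      exact Subtype.ext ((R.sameCycle_iff d d').1 h)
    · intro q q' h
      induction q using Quotient.inductionOn
      induction q' using Quotient.inductionOn
      exact Quotient.sound ((R.sameCycle_iff _ _).2 (Subtype.ext_iff.1 h))
    · rintro ⟨_, d, rfl⟩
      exact ⟨Quotient.mk _ d, rfl⟩
  have hiso : (Set.range R.tail).ncard + {v ∈ G.vertexSet | ∀ e, ¬ G.Inc e v}.ncard =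
      G.vertexSet.ncard := by
    rw [← Set.ncard_union_eq ?_ (Set.finite_range _) (hV.subset fun _ h => h.1)]
    · congr 1
      ext v
      constructor
      · rintro (⟨d, rfl⟩ | h)
        · exact R.isTail.mem d
        · exact h.1
      · intro hv
        by_cases h : ∃ e, G.Inc e v
        · obtain ⟨e, y, h⟩ := h
          obtain ⟨d, -, hd, -⟩ := R.isTail.exists_dart h
          exact .inl ⟨d, hd⟩
        · exact .inr ⟨hv, by simpa using h⟩
    · rw [Set.disjoint_left]
      rintro _ ⟨d, rfl⟩ h
      exact h.2 _ ⟨_, R.isTail.isLink d⟩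
  have hs := Equiv.Perm.sign_eq_neg_one_pow_card_quotient R.facePerm
  rw [facePerm, Equiv.Perm.sign_mul, hrev, Equiv.Perm.sign_eq_neg_one_pow_card_quotient R.next,
    card_dartType, hnext, ← pow_add] at hs
  have hpar : ∀ a b : ℕ, ((-1 : ℤˣ) ^ a = (-1) ^ b) → Even (a + b) := by
    intro a b h
    rw [← neg_one_pow_eq_one_iff_even (R := ℤˣ) (by decide), pow_add, h, ← pow_add, ← two_mul,
      pow_mul]
    simp
  have hev := hpar _ _ hs
  change Even (_ + (2 * G.edgeSet.ncard +
    Nat.card (Quotient (Equiv.Perm.SameCycle.setoid R.facePerm)))) at hev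
  rw [numFaces]
  rw [Nat.even_iff] at hev ⊢
  omega

end RotationSystem

end Graph

/-! ### Dissolving trivalent vertices of a one-face embedding -/

namespace Equiv.Perm

variable {D α : Type*} {τ : D → α} {Q : Set D} {ν ρ : Perm D}

lemma three_cycle_apply [DecidableEq D] {a b c : D} (hab : a ≠ b) (hac : a ≠ c) (hbc : b ≠ c) :
    (swap a b * swap b c) a = b ∧ (swap a b * swap b c) b = c ∧ (swap a b * swap b c) c = a ∧
      ∀ x ∉ ({a, b, c} : Set D), (swap a b * swap b c) x = x := by
  refine ⟨?_, ?_, ?_, ?_⟩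
  · rw [Perm.mul_apply, swap_apply_of_ne_of_ne hab hac, swap_apply_left]
  · rw [Perm.mul_apply, swap_apply_left, swap_apply_of_ne_of_ne hac.symm hbc.symm]
  · rw [Perm.mul_apply, swap_apply_right, swap_apply_right]
  · intro x hx
    simp only [Set.mem_insert_iff, Set.mem_singleton_iff, not_or] at hx
    rw [Perm.mul_apply, swap_apply_of_ne_of_ne hx.2.1 hx.2.2, swap_apply_of_ne_of_ne hx.1 hx.2.1]

variable [Finite D]

/-- A 3-valent vertex at which `ν` is not the first return map of `ν * ρ` can be dissolved
without destroying the single cycle of `ν * ρ`. -/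
lemma Glued.exists_unglue (hν : Glued τ Q ν) (hφ : ∀ d d', (ν * ρ).SameCycle d d') {v : α}
    (hv : {d | τ d = v}.ncard ≤ 3) {a : D} (ha : τ a = v)
    (hQ : {d | τ d = v} ⊆ Q)
    (hbad : ¬ (ν * ρ).FirstReturn {d | ν.SameCycle a d} a (ν a)) :
    {d | τ d = v}.ncard = 3 ∧ ∃ ν' : Perm D, Glued τ (Q \ {d | τ d = v}) ν' ∧
      ∀ d d', (ν' * ρ).SameCycle d d' := by
  classical
  set O : Set D := {d | τ d = v} with hO
  have hsc : {d | ν.SameCycle a d} = O := by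
    ext d
    rw [Set.mem_ofPred_eq, hν a d, hO, Set.mem_ofPred_eq]
    constructor
    · rintro (rfl | h)
      · exact ha
      · rw [← h.1, ha]
    · exact fun h => .inr ⟨ha.trans h.symm, hQ ha, hQ h⟩
  rw [hsc] at hbad
  have haO : a ∈ O := ha
  have hνO : ∀ d ∈ O, ν d ∈ O := fun d hd => (hν.apply d).trans hd
  -- a second point is never missed
  obtain ⟨t, ht⟩ := exists_firstReturn (ν * ρ) haO
  have hta : ∀ b ∈ O, b ≠ a → t ≠ a := by
    rintro b hb hba rfl
    refine hba (mem_of_firstReturn_closed (P := {t}) (O := O) (f := ν * ρ) ?_ rfl hb (hφ _ _))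
    rintro s rfl u hu
    exact hu.unique ht
  have hνne : ∀ d ∈ O, ∀ b ∈ O, b ≠ d → ν d ≠ d := by
    intro d hd b hb hbd h
    refine hbd ?_
    have h' : ν.SameCycle d b := (hν d b).2 (.inr ⟨hd.trans hb.symm, hQ hd, hQ hb⟩)
    exact (h'.eq_of_left h).symm
  have hνa : ν a ≠ a := by
    intro h
    have : ∃ b ∈ O, b ≠ a := by
      by_contra! hcon
      rw [hcon t ht.1] at ht
      exact hbad (by rwa [h])
    obtain ⟨b, hb, hba⟩ := this
    exact hνne a ha b hb hba h
  have htν : t ≠ ν a := by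
    rintro rfl
    exact hbad ht
  have hta' : t ≠ a := hta _ (hνO a ha) hνa
  -- Degree at most two leaves no room for a disagreement: `a`, `ν a` and the first return `t` are
  -- distinct, hence they are all the darts at `v`.
  have hO3 : O = {a, ν a, t} := by
    refine (Set.eq_of_subset_of_ncard_le ?_ ?_).symm
    · rintro x (rfl | rfl | rfl)
      exacts [ha, hνO _ ha, ht.1]
    · rwa [Set.ncard_eq_three.2 ⟨a, ν a, t, hνa.symm, hta'.symm, htν.symm, rfl⟩]
  refine ⟨by rw [hO3, Set.ncard_eq_three.2 ⟨a, ν a, t, hνa.symm, hta'.symm, htν.symm, rfl⟩], ?_⟩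
  set b := ν a with hb
  have hbO : b ∈ O := hνO a ha
  have hνb : ν b = t := by
    have h1 : ν b ≠ b := hνne b hbO a ha hνa.symm
    have h2 : ν b ≠ a := by
      intro h2
      have hcl : ∀ x ∈ ({a, b} : Set D), ν x ∈ ({a, b} : Set D) := by
        rintro x (rfl | rfl)
        · exact .inr rfl
        · exact .inl h2
      have h' : ν.SameCycle a t := (hν a t).2 (.inr ⟨ha.trans ht.1.symm, hQ ha, hQ ht.1⟩)
      obtain ⟨i, -, hi⟩ := h'.exists_pow_eq'
      have : ∀ i : ℕ, (ν ^ i) a ∈ ({a, b} : Set D) := by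
        intro i
        induction i with
        | zero => simp
        | succ i ih => rw [pow_succ', Perm.mul_apply]; exact hcl _ ih
      rcases hi ▸ this i with h | h
      · exact hta' h
      · exact htν h
    rcases hO3 ▸ hνO b hbO with h | h | h
    · exact absurd h h2
    · exact absurd h h1
    · exact h
  have hνt : ν t = a := by
    rcases hO3 ▸ hνO t ht.1 with h | h | h
    · exact h
    · exact absurd (ν.injective h) hta'
    · exact absurd (ν.injective (h.trans hνb.symm)) htν
  rcases firstReturn_three hνa.symm hta'.symm htν.symm (hφ a b) (hφ a t) with h | ⟨h1, h2, h3⟩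
  · exact absurd (hO3 ▸ h.1) hbad
  -- The face visits the darts in the order a, t, b, opposite to ν, so the 3-cycle (a t b) both
  -- cancels ν at `v` and preserves the single face.
  obtain ⟨k1, k2, k3, k4⟩ := three_cycle_apply hta'.symm hνa.symm htν
  have hset : ({a, t, b} : Set D) = {a, b, t} := by
    rw [Set.pair_comm t b]
  refine ⟨swap a t * swap t b * ν, hν.unglue hO ?_ ?_, fun d d' => ?_⟩
  · rw [hO3, ← hset]
    exact k4
  · rw [hO3]
    rintro x (rfl | rfl | rfl)
    · exact k3
    · rw [hνb]
      exact k2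
    · rw [hνt]
      exact k1
  · rw [mul_assoc]
    rw [← hset] at h1 h2 h3
    exact SameCycle.mul_three h1 h2 h3 k4 k1 k2 k3 (hφ d d')

/-- Dissolving 3-valent vertices as long as `ν * ρ` remains a single cycle. -/
lemma exists_fully_unglued (hν : ∀ d d', ν.SameCycle d d' ↔ τ d = τ d')
    (hφ : ∀ d d', (ν * ρ).SameCycle d d') (h3 : ∀ d, {d' | τ d' = τ d}.ncard ≤ 3) :
    ∃ (B : Set α) (ν' : Perm D), Glued τ (τ ⁻¹' B) ν' ∧ (∀ d d', (ν' * ρ).SameCycle d d') ∧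
      (∀ d, τ d ∉ B → {d' | τ d' = τ d}.ncard = 3) ∧
      ∀ a, (ν' * ρ).FirstReturn {d | ν'.SameCycle a d} a (ν' a) := by
  classical
  -- `B` holds the vertices that are still assembled, and a smallest `B` is taken; it is kept inside
  -- the range of `τ` so that it is finite.
  let P : ℕ → Prop := fun n => ∃ (B : Set α) (ν' : Perm D), B ⊆ Set.range τ ∧ B.ncard = n ∧
    Glued τ (τ ⁻¹' B) ν' ∧ (∀ d d', (ν' * ρ).SameCycle d d') ∧
    (∀ d, τ d ∉ B → {d' | τ d' = τ d}.ncard = 3)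
  have hP : ∃ n, P n := by
    refine ⟨_, Set.range τ, ν, subset_rfl, rfl, fun d d' => ?_, hφ, fun d hd => ?_⟩
    · rw [hν]
      constructor
      · exact fun h => .inr ⟨h, ⟨d, rfl⟩, ⟨d', rfl⟩⟩
      · rintro (rfl | h)
        exacts [rfl, h.1]
    · exact absurd ⟨d, rfl⟩ hd
  obtain ⟨B, ν', hBr, hBn, hg, hφ', hB3⟩ := Nat.find_spec hP
  refine ⟨B, ν', hg, hφ', hB3, fun a => ?_⟩
  by_contra hbad
  by_cases haB : τ a ∈ B
  · obtain ⟨h3', ν'', hg', hφ''⟩ := hg.exists_unglue hφ' (h3 a) rfl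
      (fun d (hd : τ d = τ a) => by rw [Set.mem_preimage, hd]; exact haB) hbad
    have hfin : B.Finite := (Set.finite_range τ).subset hBr
    refine Nat.find_min hP (m := (B \ {τ a}).ncard) ?_ ⟨B \ {τ a}, ν'',
      Set.sdiff_subset.trans hBr, rfl, ?_, hφ'', ?_⟩
    · rw [← hBn]
      exact Set.ncard_sdiff_singleton_lt_of_mem haB hfin
    · exact hg'
    · intro d hd
      by_cases hda : τ d = τ a
      · rw [hda, h3']
      · exact hB3 d fun h => hd ⟨h, hda⟩
  -- A dangling dart is its own cycle of ν', to which it trivially returns.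
  · apply hbad
    have h1 : ν' a = a := hg.apply_eq_self haB
    have h2 : {d | ν'.SameCycle a d} = {a} := by
      ext d
      rw [Set.mem_ofPred_eq, hg a d]
      constructor
      · rintro (rfl | h)
        · rfl
        · exact absurd h.2.1 haB
      · exact fun h => .inl (Eq.symm h)
    rw [h1, h2]
    obtain ⟨t, ht⟩ := exists_firstReturn (ν' * ρ) (Set.mem_singleton a)
    rwa [show t = a from ht.1] at ht

end Equiv.Perm

/-! ### From a one-face embedding to an induced tree -/

namespace Graph

variable {α β : Type*} {G : Graph α β}

lemma reach_symm {x y : α} (h : Relation.ReflTransGen G.Adj x y) :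
    Relation.ReflTransGen G.Adj y x := by
  induction h with
  | refl => exact .refl
  | tail _ h ih => exact .head h.symm ih

lemma RotationSystem.sameCycle_facePerm_of_numFaces_le_one (R : G.RotationSystem)
    (hE : G.edgeSet.Finite) (h : R.numFaces ≤ 1) (d d' : G.DartType) :
    R.facePerm.SameCycle d d' := by
  have := hE.to_subtype
  have : Nat.card (Quotient (Equiv.Perm.SameCycle.setoid R.facePerm)) ≤ 1 :=
    (Nat.le_add_right _ _).trans h
  rw [Finite.card_le_one_iff_subsingleton] at this
  exact Quotient.exact (this.elim (Quotient.mk _ d) (Quotient.mk _ d'))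

/-- A graph of maximum degree at most three with a one-face embedding is obtained from an induced
tree by adding independent 3-valent vertices. -/
lemma RotationSystem.exists_induced_tree (R : G.RotationSystem) (hE : G.edgeSet.Finite)
    (hconn : G.IsConn) (hface : R.numFaces ≤ 1) (hdeg : ∀ v ∈ G.vertexSet, G.vertexDegree v ≤ 3) :
    ∃ J ⊆ G.vertexSet, (∀ v ∈ J, G.vertexDegree v = 3) ∧
      (∀ e x y, G.IsLink e x y → x ∈ J → y ∉ J) ∧ (G.induce (G.vertexSet \ J)).IsTreeGraph := by
  classical
  have := hE.to_subtype
  have ht : G.IsTail R.tail := R.isTail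
  set τ := R.tail with hτ
  obtain ⟨B, ν, hg, hφ, hB3, hF⟩ := Equiv.Perm.exists_fully_unglued R.sameCycle_iff
    (R.sameCycle_facePerm_of_numFaces_le_one hE hface)
    (fun d => by rw [← vertexDegree_eq_ncard ht hE]; exact hdeg _ (ht.mem d))
  set ρ := G.dartRev with hρ
  -- An edge with two dangling ends forms a face of its own. As there is only one face, the graph
  -- would have just two darts, but a dissolved vertex has three.
  have hindep : ∀ d, τ d ∉ B → τ (ρ d) ∈ B := by
    intro d hd
    by_contra hd'
    have h1 : ∀ d', d' ∈ ({d, ρ d} : Set G.DartType) := by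
      intro d'
      obtain ⟨i, -, hi⟩ := (hφ d d').exists_pow_eq'
      rw [← hi]
      clear hi
      induction i with
      | zero => simp
      | succ i ih =>
        rw [pow_succ', Equiv.Perm.mul_apply]
        rcases ih with h | h
        · rw [h, Equiv.Perm.mul_apply, hg.apply_eq_self hd']
          simp
        · rw [h, Equiv.Perm.mul_apply, dartRev_dartRev, hg.apply_eq_self hd]
          simp
    have h2 : {d' | τ d' = τ d}.ncard = 3 := hB3 d hd
    have h3 : {d' | τ d' = τ d}.ncard ≤ ({d, ρ d} : Set G.DartType).ncard :=
      Set.ncard_le_ncard (fun d' _ => h1 d')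
    have h4 : ({d, ρ d} : Set G.DartType).ncard = 2 := Set.ncard_pair (dartRev_ne d).symm
    omega
  have hadj : ∀ d, τ d ∈ B → τ (ρ d) ∈ B →
      (G.induce (G.vertexSet ∩ B)).IsLink d.1 (τ d) (τ (ρ d)) :=
    fun d h h' => ⟨ht.isLink d, ⟨ht.mem _, h⟩, ⟨ht.mem _, h'⟩⟩
  refine ⟨{v ∈ G.vertexSet | v ∉ B ∧ ∃ d, τ d = v}, fun v h => h.1, ?_, ?_, ?_⟩
  · rintro v ⟨-, hv, d, rfl⟩
    rw [vertexDegree_eq_ncard ht hE, hB3 d hv]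
  · rintro e x y h ⟨-, hx, -⟩ ⟨-, hy, -⟩
    obtain ⟨d, -, rfl, rfl⟩ := ht.exists_dart h
    exact hy (hindep d hx)
  by_cases hne : Nonempty G.DartType
  swap
  · -- a single vertex
    rw [not_nonempty_iff] at hne
    have hno : ∀ e x y, ¬ G.IsLink e x y := by
      intro e x y h
      obtain ⟨d, -⟩ := ht.exists_dart h
      exact hne.elim d
    have hJ : {v ∈ G.vertexSet | v ∉ B ∧ ∃ d, τ d = v} = ∅ := by
      ext v
      simp only [Set.mem_ofPred_eq, Set.mem_empty_iff_false, iff_false, not_and, not_exists]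
      exact fun _ _ d => hne.elim d
    rw [hJ, Set.sdiff_empty, induce_vertexSet]
    refine ⟨hconn, fun e he => ?_⟩
    obtain ⟨x, y, h⟩ := exists_isLink_of_mem_edgeSet he
    exact absurd h (hno e x y)
  have hall : ∀ v ∈ G.vertexSet, ∃ d, τ d = v := by
    intro v hv
    obtain ⟨d₀⟩ := hne
    by_cases hvd : τ d₀ = v
    · exact ⟨d₀, hvd⟩
    rcases (hconn.2 v hv _ (ht.mem d₀)).cases_head with h | ⟨c, ⟨e, h⟩, -⟩
    · exact ⟨d₀, h.symm⟩
    · obtain ⟨d, -, h, -⟩ := ht.exists_dart h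
      exact ⟨d, h⟩
  have hset : G.vertexSet \ {v ∈ G.vertexSet | v ∉ B ∧ ∃ d, τ d = v} = G.vertexSet ∩ B := by
    ext v
    constructor
    · rintro ⟨h, h'⟩
      refine ⟨h, ?_⟩
      by_contra hB
      exact h' ⟨h, hB, hall v h⟩
    · rintro ⟨h, h'⟩
      exact ⟨h, fun h'' => h''.2.1 h'⟩
  rw [hset]
  refine ⟨⟨?_, ?_⟩, ?_⟩
  · obtain ⟨d⟩ := hne
    by_cases h : τ d ∈ B
    · exact ⟨_, ht.mem d, h⟩
    · exact ⟨_, ht.mem _, hindep d h⟩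
  · have key : ∀ d d', Relation.ReflTransGen (G.induce (G.vertexSet ∩ B)).Adj
        (if τ d ∈ B then τ d else τ (ρ d)) (if τ d' ∈ B then τ d' else τ (ρ d')) := by
      intro d d'
      refine Equiv.Perm.SameCycle.rel (f := ν * ρ)
        (R := fun d d' => Relation.ReflTransGen (G.induce (G.vertexSet ∩ B)).Adj
          (if τ d ∈ B then τ d else τ (ρ d)) (if τ d' ∈ B then τ d' else τ (ρ d')))
        ⟨fun _ => .refl, reach_symm, .trans⟩ ?_ (hφ d d')
      intro d
      have htail : τ ((ν * ρ) d) = τ (ρ d) := hg.apply _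
      by_cases h : τ d ∈ B
      · by_cases h' : τ (ρ d) ∈ B
        · rw [if_pos h, if_pos (htail ▸ h'), htail]
          exact .single ⟨_, hadj d h h'⟩
        · have : (ν * ρ) d = ρ d := hg.apply_eq_self h'
          rw [if_pos h, this, if_neg h', dartRev_dartRev]
      · have h' := hindep d h
        rw [if_neg h, if_pos (htail ▸ h'), htail]
    rintro x ⟨hx, hxB⟩ y ⟨hy, hyB⟩
    obtain ⟨d, rfl⟩ := hall x hx
    obtain ⟨d', rfl⟩ := hall y hy
    simpa [hxB, hyB] using key d d'
  · intro e he
    obtain ⟨x, y, h, ⟨-, hx⟩, ⟨-, hy⟩⟩ := exists_isLink_of_mem_edgeSet he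
    obtain ⟨a, rfl, rfl, rfl⟩ := ht.exists_dart h
    obtain ⟨S, haS, hρS, hνS, hrS⟩ :=
      Equiv.Perm.exists_separating_set dartRev_dartRev dartRev_ne hF a
    refine ⟨_, _, (hadj a hx hy).symm, fun hreach => ?_⟩
    -- Without the edge of `a`, a walk from `τ (ρ a)` stays among the vertices with darts in `S`;
    -- the other end of the edge has its darts outside.
    have hinv : ∀ w, Relation.ReflTransGen
        ((G.induce (G.vertexSet ∩ B)).deleteEdges {a.1.1}).Adj (τ (ρ a)) w →
        ∃ d ∈ S, τ d = w := by
      intro w hw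
      induction hw with
      | refl => exact ⟨_, hρS, rfl⟩
      | tail _ hadj ih =>
        obtain ⟨d, hdS, rfl⟩ := ih
        obtain ⟨f, hf⟩ := hadj
        rw [deleteEdges_isLink] at hf
        obtain ⟨⟨hf, ⟨-, hb⟩, -⟩, hfa⟩ := hf
        obtain ⟨d', rfl, hd', rfl⟩ := ht.exists_dart hf
        have hd'S : d' ∈ S := hνS d hdS d' ((hg d d').2
          (.inr ⟨hd'.symm, hb, show τ d' ∈ B by rw [hd']; exact hb⟩))
        refine ⟨_, hrS d' hd'S ?_, rfl⟩
        rintro rfl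
        exact hfa rfl
    obtain ⟨d, hdS, hd⟩ := hinv _ hreach
    exact haS (hνS d hdS a ((hg d a).2
      (.inr ⟨hd, show τ d ∈ B by rw [hd]; exact hx, hx⟩)))

end Graph

/-! ### Gluing darts to vertices -/

namespace Equiv.Perm

variable {D α : Type*} [Finite D] {τ : D → α} {Q : Set D} {ν ρ : Perm D}

/-- Gluing the darts of a vertex `u`, all but one of whose edges are still isolated. -/
lemma Glued.exists_glue_vertex (hρ : ∀ d, ρ (ρ d) = d) (hν : Glued τ Q ν)
    {u : α} (hu : ∀ d ∈ Q, τ d ≠ u) {a : D}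
    (ha : τ a = u) (haQ : ∀ d ∈ Q, (ν * ρ).SameCycle d a)
    (hw : ∀ w, τ w = u → w ≠ a → ρ w ∉ Q ∧ τ (ρ w) ≠ u) :
    ∃ ν' : Perm D, Glued τ (Q ∪ {d | τ d = u}) ν' ∧
      ∀ d ∈ Q ∪ {d | τ d = u}, ∀ d' ∈ Q ∪ {d | τ d = u}, (ν' * ρ).SameCycle d d' := by
  classical
  have key : ∃ ν' : Perm D, Glued τ (insert a Q ∪ ({d | τ d = u} \ {a})) ν' ∧
      ∀ d ∈ insert a Q ∪ ({d | τ d = u} \ {a}), (ν' * ρ).SameCycle a d := by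
    -- The dart `a` is glued from the start, and the others at `u` are joined to it one by one. Each
    -- of them still lies on a face consisting of itself and its reversal, so each transposition
    -- merges two faces.
    refine Set.Finite.induction_on_subset (motive := fun W _ => ∃ ν' : Perm D,
      Glued τ (insert a Q ∪ W) ν' ∧ ∀ d ∈ insert a Q ∪ W, (ν' * ρ).SameCycle a d)
      ({d | τ d = u} \ {a}) (Set.toFinite _) ?_ ?_
    · rw [Set.union_empty]
      refine ⟨ν, hν.insert_free fun d hd => by rw [ha]; exact hu d hd, ?_⟩
      rintro d (rfl | hd)
      · exact .rfl
      · exact (haQ d hd).symm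
    · rintro w W ⟨hwu, hwa⟩ hW hwW ⟨ν', hg, hs⟩
      have hwQ : w ∉ insert a Q ∪ W := by
        rintro ((h | h) | h)
        · exact hwa h
        · exact hu w h hwu
        · exact hwW h
      have hρw : ρ w ∉ insert a Q ∪ W := by
        obtain ⟨h1, h2⟩ := hw w hwu hwa
        rintro ((h | h) | h)
        · exact h2 (h ▸ ha)
        · exact h1 h
        · exact h2 (hW h).1
      have hns : ¬ (ν' * ρ).SameCycle a w := by
        intro h
        obtain ⟨i, -, hi⟩ := h.symm.exists_pow_eq'
        have : ∀ i : ℕ, ((ν' * ρ) ^ i) w ∈ ({w, ρ w} : Set D) := by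
          intro i
          induction i with
          | zero => simp
          | succ i ih =>
            rw [pow_succ', Perm.mul_apply]
            rcases ih with h | h
            · rw [h, Perm.mul_apply, hg.apply_eq_self hρw]
              simp
            · rw [h, Perm.mul_apply, hρ, hg.apply_eq_self hwQ]
              simp
        rcases hi ▸ this i with h | h
        · exact hwa h.symm
        · exact hρw (h ▸ .inl (.inl rfl))
      refine ⟨swap a w * ν', ?_, ?_⟩
      · have := hg.insert_swap (.inl (.inl rfl)) hwQ (ha.trans hwu.symm)
        rwa [← Set.union_insert] at this
      · rw [Set.union_insert, mul_assoc]
        rintro d (rfl | hd)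
        · exact sameCycle_swap_mul hns
        · exact (hs d hd).swap_mul hns
  have hset : insert a Q ∪ ({d | τ d = u} \ {a}) = Q ∪ {d | τ d = u} := by
    ext d
    by_cases h : d = a
    · simp [h, ha]
    · simp [h]
  rw [hset] at key
  obtain ⟨ν', hg, hs⟩ := key
  exact ⟨ν', hg, fun d hd d' hd' => (hs d hd).symm.trans (hs d' hd')⟩

lemma Glued.three [DecidableEq D] (hν : Glued τ Q ν) {a b c : D} (hab : a ≠ b) (hac : a ≠ c)
    (hbc : b ≠ c) (hτb : τ b = τ a) (hτc : τ c = τ a) (hQ : ∀ d ∈ Q, τ d ≠ τ a) :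
    Glued τ (Q ∪ {a, b, c}) (swap a b * swap b c * ν) := by
  have h1 : Glued τ (insert b Q) ν := hν.insert_free (by rwa [hτb])
  have h2 := h1.insert_swap (a := b) (b := c) (.inl rfl) (by
    rintro (h | h)
    · exact hbc h.symm
    · exact hQ _ h hτc) (hτb.trans hτc.symm)
  have h3 := h2.insert_swap (a := b) (b := a) (.inr (.inl rfl)) (by
    rintro (h | h | h)
    · exact hac h
    · exact hab h
    · exact hQ _ h rfl) hτb
  rw [swap_comm b a, ← mul_assoc] at h3
  convert! h3 using 1
  ext d
  simp only [Set.mem_union, Set.mem_insert_iff, Set.mem_singleton_iff]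
  tauto

/-- The three darts lie on the single face in one of two cyclic orders; taking that order as the
rotation keeps the face in one piece. -/
lemma Glued.exists_glue_three (hν : Glued τ Q ν) (hφ : ∀ d d', (ν * ρ).SameCycle d d') {v : α}
    (hv : {d | τ d = v}.ncard = 3) (hQ : ∀ d ∈ Q, τ d ≠ v) :
    ∃ ν' : Perm D, Glued τ (Q ∪ {d | τ d = v}) ν' ∧ ∀ d d', (ν' * ρ).SameCycle d d' := by
  classical
  obtain ⟨a, b, c, hab, hac, hbc, hO⟩ := Set.ncard_eq_three.1 hv
  have ha : τ a = v := show a ∈ {d | τ d = v} by rw [hO]; simp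
  have hb : τ b = v := show b ∈ {d | τ d = v} by rw [hO]; simp
  have hc : τ c = v := show c ∈ {d | τ d = v} by rw [hO]; simp
  rw [hO]
  rcases firstReturn_three hab hac hbc (hφ a b) (hφ a c) with ⟨h1, h2, h3⟩ | ⟨h1, h2, h3⟩
  · obtain ⟨k1, k2, k3, k4⟩ := three_cycle_apply hab hac hbc
    refine ⟨swap a b * swap b c * ν, hν.three hab hac hbc (hb.trans ha.symm) (hc.trans ha.symm)
      (by rwa [ha]), fun d d' => ?_⟩
    rw [mul_assoc]
    exact SameCycle.mul_three h1 h2 h3 k4 k1 k2 k3 (hφ d d')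
  · obtain ⟨k1, k2, k3, k4⟩ := three_cycle_apply hac hab hbc.symm
    have hset : ({a, b, c} : Set D) = {a, c, b} := by rw [Set.pair_comm b c]
    rw [hset] at h1 h2 h3 ⊢
    refine ⟨swap a c * swap c b * ν, hν.three hac hab hbc.symm (hc.trans ha.symm)
      (hb.trans ha.symm) (by rwa [ha]), fun d d' => ?_⟩
    rw [mul_assoc]
    exact SameCycle.mul_three h1 h2 h3 k4 k1 k2 k3 (hφ d d')

lemma Glued.exists_glue_set (hν : Glued τ Q ν) (hφ : ∀ d d', (ν * ρ).SameCycle d d') {J : Set α}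
    (hJ : J.Finite) (h3 : ∀ v ∈ J, {d | τ d = v}.ncard = 3) (hQ : ∀ d ∈ Q, τ d ∉ J) :
    ∃ ν' : Perm D, Glued τ (Q ∪ τ ⁻¹' J) ν' ∧ ∀ d d', (ν' * ρ).SameCycle d d' := by
  refine Set.Finite.induction_on_subset (motive := fun W _ => ∃ ν' : Perm D,
      Glued τ (Q ∪ τ ⁻¹' W) ν' ∧ ∀ d d', (ν' * ρ).SameCycle d d') J hJ ?_ ?_
  · exact ⟨ν, by simpa using hν, hφ⟩
  · rintro v W hv hW hvW ⟨ν', hg, hs⟩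
    obtain ⟨ν'', hg', hs'⟩ := hg.exists_glue_three hs (h3 v hv) (by
      rintro d (hd | hd) rfl
      · exact hQ d hd hv
      · exact hvW hd)
    refine ⟨ν'', ?_, hs'⟩
    convert! hg' using 1
    rw [Set.union_assoc]
    congr 1
    ext d
    simp [or_comm]

end Equiv.Perm

/-! ### Embeddings with few faces from an induced tree -/

namespace Graph

variable {α β : Type*} {G : Graph α β}

open Relation

lemma exists_crossing {r : α → α → Prop} {S : Set α} {x y : α} (h : ReflTransGen r x y)
    (hx : x ∈ S) (hy : y ∉ S) : ∃ a ∈ S, ∃ b ∉ S, r a b := by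
  induction h with
  | refl => exact absurd hx hy
  | @tail b c _ hbc ih =>
    by_cases hb : b ∈ S
    · exact ⟨b, hb, c, hy, hbc⟩
    · exact ih hb

lemma IsBridge.not_reach {e : β} {x y : α} (h : G.IsBridge e) (hl : G.IsLink e x y) :
    ¬ ReflTransGen (G.deleteEdges {e}).Adj x y := by
  obtain ⟨x', y', hl', h⟩ := h
  rcases hl.eq_and_eq_or_eq_and_eq hl' with ⟨rfl, rfl⟩ | ⟨rfl, rfl⟩
  · exact h
  · exact fun h' => h (reach_symm h')

lemma reach_of_imp {r s : α → α → Prop} (hrs : ∀ x y, r x y → s x y) {x y : α}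
    (h : ReflTransGen r x y) : ReflTransGen s x y :=
  ReflTransGen.mono hrs _ _ h

lemma reach_mono {H : Graph α β} (hle : H ≤ G) {x y : α} (h : ReflTransGen H.Adj x y) :
    ReflTransGen G.Adj x y :=
  reach_of_imp (fun _ _ h => h.mono hle) h

lemma IsTreeGraph.ne_of_isLink (h : G.IsTreeGraph) {e : β} {x y : α} (hl : G.IsLink e x y) :
    x ≠ y := by
  rintro rfl
  exact (h.2 e hl.edge_mem).not_reach hl .refl

/-- An induced tree has a one-face embedding in which all the edges that meet it are present,
dangling where they leave the tree. -/
lemma exists_glued_of_tree {t : G.DartType → α} (ht : G.IsTail t) (hE : G.edgeSet.Finite)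
    {A : Set α} (hA : A.Finite) (hT : (G.induce A).IsTreeGraph) :
    ∃ ν : Equiv.Perm G.DartType, Equiv.Perm.Glued t (t ⁻¹' A) ν ∧
      ∀ d ∈ t ⁻¹' A, ∀ d' ∈ t ⁻¹' A, (ν * G.dartRev).SameCycle d d' := by
  have := hE.to_subtype
  have hloop : ∀ d, t d ∈ A → t (G.dartRev d) ≠ t d := fun d hd h =>
    hT.ne_of_isLink (x := t d) (y := t (G.dartRev d)) ⟨ht.isLink d, hd, by rwa [h]⟩ h.symm
  -- The tree is grown from one vertex, by one adjacent vertex at a time; `n + 1` keeps `B`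
  -- nonempty. Connectedness of `B` is carried along to exclude a second edge to the new vertex.
  have key : ∀ n, n + 1 ≤ A.ncard → ∃ B ⊆ A, B.ncard = n + 1 ∧
      (∀ x ∈ B, ∀ y ∈ B, ReflTransGen (G.induce B).Adj x y) ∧
      ∃ ν : Equiv.Perm G.DartType, Equiv.Perm.Glued t (t ⁻¹' B) ν ∧
        ∀ d ∈ t ⁻¹' B, ∀ d' ∈ t ⁻¹' B, (ν * G.dartRev).SameCycle d d' := by
    intro n
    induction n with
    | zero =>
      intro _
      obtain ⟨r, hr⟩ := hT.1.1
      refine ⟨{r}, by simpa using hr, by simp, by rintro x rfl y rfl; exact .refl, ?_⟩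
      by_cases hd : ∃ d, t d = r
      · obtain ⟨a, ha⟩ := hd
        obtain ⟨ν, hν, hs⟩ := (Equiv.Perm.Glued.one t).exists_glue_vertex (ρ := G.dartRev)
          dartRev_dartRev (u := r) (by simp) ha (by simp)
          (by rintro w rfl -; exact ⟨by simp, hloop w hr⟩)
        rw [Set.empty_union] at hν hs
        exact ⟨ν, hν, hs⟩
      · have : t ⁻¹' {r} = ∅ := by
          ext d
          simpa using fun h => hd ⟨d, h⟩
        rw [this]
        exact ⟨1, .one t, by simp⟩
    | succ n ih =>
      intro hn
      obtain ⟨B, hBA, hBn, hBc, ν, hν, hs⟩ := ih (by omega)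
      obtain ⟨u', hu'A, hu'B⟩ : ∃ u' ∈ A, u' ∉ B := by
        by_contra! h
        have := Set.ncard_le_ncard (show A ⊆ B from h) (hA.subset hBA)
        omega
      obtain ⟨b', hb'⟩ : B.Nonempty := by
        rw [← Set.ncard_pos (hA.subset hBA)]
        omega
      obtain ⟨b, hb, u, hu, e, hbu, hbA, huA⟩ :=
        exists_crossing (hT.1.2 b' (hBA hb') u' hu'A) hb' hu'B
      obtain ⟨a, rfl, rfl, rfl⟩ := ht.exists_dart hbu.symm
      -- A second edge from the new vertex into `B` would close a cycle through the edge of `a`,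
      -- which is a bridge.
      have huniq : ∀ w, t w = t a → w ≠ a → t (G.dartRev w) ∉ B := by
        intro w hw hwa hwB
        have hne : w.1.1 ≠ a.1.1 := by
          intro h
          rcases eq_or_eq_dartRev (Subtype.ext h) with rfl | rfl
          · exact hwa rfl
          · exact hu (hw ▸ hb)
        have hlink : (G.induce A).IsLink a.1.1 (t (G.dartRev a)) (t a) := ⟨hbu, hbA, huA⟩
        refine (hT.2 _ hlink.edge_mem).not_reach hlink ?_
        refine ReflTransGen.tail (b := t (G.dartRev w)) ?_ ?_
        · refine reach_of_imp ?_ (hBc _ hb _ hwB)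
          rintro p q ⟨f, hf, hp, hq⟩
          refine ⟨f, ⟨hf, hBA hp, hBA hq⟩, ?_⟩
          rintro rfl
          rcases hf.eq_and_eq_or_eq_and_eq hbu with ⟨-, h⟩ | ⟨h, -⟩
          · exact hu (h ▸ hq)
          · exact hu (h ▸ hp)
        · refine ⟨w.1.1, ⟨hw ▸ (ht.isLink w).symm, hBA hwB, huA⟩, hne⟩
      refine ⟨insert (t a) B, Set.insert_subset huA hBA, ?_, ?_, ?_⟩
      · rw [Set.ncard_insert_of_notMem hu (hA.subset hBA), hBn]
      · have h1 : ∀ x ∈ insert (t a) B,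
            ReflTransGen (G.induce (insert (t a) B)).Adj (t (G.dartRev a)) x := by
          rintro x (rfl | hx)
          · exact .single ⟨_, hbu, .inr hb, .inl rfl⟩
          · refine reach_of_imp ?_ (hBc _ hb _ hx)
            rintro p q ⟨f, hf, hp, hq⟩
            exact ⟨f, hf, .inr hp, .inr hq⟩
        exact fun x hx y hy => (reach_symm (h1 x hx)).trans (h1 y hy)
      · obtain ⟨ν', hν', hs'⟩ := hν.exists_glue_vertex (ρ := G.dartRev) dartRev_dartRev
          (u := t a) (fun d hd h => hu (h ▸ hd)) rfl (by
            intro d hd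
            rw [← Equiv.Perm.sameCycle_apply_right]
            exact hs d hd _ (hν.apply_mem hb))
          (fun w hw hwa => ⟨huniq w hw hwa, by rw [← hw]; exact hloop w (hw ▸ huA)⟩)
        have hset : t ⁻¹' B ∪ {d | t d = t a} = t ⁻¹' (insert (t a) B) := by
          ext d
          simp [or_comm]
        rw [hset] at hν' hs'
        exact ⟨ν', hν', hs'⟩
  have hpos : 0 < A.ncard := (Set.ncard_pos hA).2 hT.1.1
  obtain ⟨B, hBA, hBn, -, h⟩ := key (A.ncard - 1) (by omega)
  obtain rfl : B = A := Set.eq_of_subset_of_ncard_le hBA (by omega) hA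
  exact h

lemma exists_rotationSystem {t : G.DartType → α} (ht : G.IsTail t) {Q : Set G.DartType}
    {ν : Equiv.Perm G.DartType} (hν : Equiv.Perm.Glued t Q ν) (hQ : ∀ d, d ∈ Q) :
    ∃ R : G.RotationSystem, R.facePerm = ν * G.dartRev := by
  refine ⟨⟨t, ht, ν, fun d d' => ?_⟩, rfl⟩
  rw [hν]
  constructor
  · rintro (rfl | h)
    exacts [rfl, h.1]
  · exact fun h => .inr ⟨h, hQ d, hQ d'⟩

/-- Adding independent 3-valent vertices to an induced tree yields a one-face embedding. -/
lemma exists_rotationSystem_of_indep (hV : G.vertexSet.Finite) (hE : G.edgeSet.Finite)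
    {A J : Set α} (hAJ : A ∪ J = G.vertexSet) (hdisj : Disjoint A J)
    (hT : (G.induce A).IsTreeGraph) (h3 : ∀ v ∈ J, G.vertexDegree v = 3)
    (hJ : ∀ e x y, G.IsLink e x y → x ∈ J → y ∉ J) :
    ∃ R : G.RotationSystem, ∀ d d', R.facePerm.SameCycle d d' := by
  have := hE.to_subtype
  obtain ⟨t, ht⟩ := G.exists_isTail
  have hAf : A.Finite := hV.subset (hAJ ▸ Set.subset_union_left)
  obtain ⟨ν, hν, hs⟩ := exists_glued_of_tree ht hE hAf hT
  have hmem : ∀ d, t d ∈ A ∨ t d ∈ J := fun d => by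
    have := ht.mem d
    rwa [← hAJ] at this
  have hall : ∀ d, ∃ d' ∈ t ⁻¹' A, (ν * G.dartRev).SameCycle d d' := by
    intro d
    by_cases hd : t d ∈ A
    · exact ⟨d, hd, .rfl⟩
    -- A dart dangling at `J` is followed on its face by a dart of `A`, so that it lies on the face
    -- around the tree.
    · have : t (G.dartRev d) ∈ A :=
        (hmem _).resolve_right (hJ _ _ _ (ht.isLink d) ((hmem d).resolve_left hd))
      exact ⟨_, hν.apply_mem this, Equiv.Perm.sameCycle_apply_right.2 .rfl⟩
  have htr : ∀ d d', (ν * G.dartRev).SameCycle d d' := by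
    intro d d'
    obtain ⟨c, hc, h⟩ := hall d
    obtain ⟨c', hc', h'⟩ := hall d'
    exact h.trans ((hs c hc c' hc').trans h'.symm)
  obtain ⟨ν', hν', hs'⟩ := hν.exists_glue_set htr
    (hV.subset (hAJ ▸ Set.subset_union_right : J ⊆ _))
    (fun v hv => by rw [← vertexDegree_eq_ncard ht hE, h3 v hv])
    (fun d hd hd' => Set.disjoint_left.1 hdisj hd hd')
  obtain ⟨R, hR⟩ := exists_rotationSystem ht hν' hmem
  exact ⟨R, hR ▸ hs'⟩

/-- Adding 3-valent vertices, two of which are joined by an edge, to an induced tree yields an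
embedding with at most two faces. -/
lemma exists_rotationSystem_of_near_indep (hV : G.vertexSet.Finite) (hE : G.edgeSet.Finite)
    {A J : Set α} (hAJ : A ∪ J = G.vertexSet) (hdisj : Disjoint A J)
    (hT : (G.induce A).IsTreeGraph) (h3 : ∀ v ∈ J, G.vertexDegree v = 3)
    {g : β} {x y : α} (hg : G.IsLink g x y) (hxy : x ≠ y) (hx : x ∈ J) (hy : y ∈ J)
    (hJ : ∀ e u v, G.IsLink e u v → u ∈ J → v ∈ J → e = g) :
    ∃ R : G.RotationSystem,
      Nat.card (Quotient (Equiv.Perm.SameCycle.setoid R.facePerm)) ≤ 2 := by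
  classical
  have := hE.to_subtype
  obtain ⟨t, ht⟩ := G.exists_isTail
  have hAf : A.Finite := hV.subset (hAJ ▸ Set.subset_union_left)
  have hJf : J.Finite := hV.subset (hAJ ▸ Set.subset_union_right)
  obtain ⟨ν, hν, hs⟩ := exists_glued_of_tree ht hE hAf hT
  have hmem : ∀ d, t d ∈ A ∨ t d ∈ J := fun d => by
    have := ht.mem d
    rwa [← hAJ] at this
  have hnot : ∀ v ∈ J, v ∉ A := fun v hv hv' => Set.disjoint_left.1 hdisj hv' hv
  obtain ⟨p, rfl, rfl, rfl⟩ := ht.exists_dart hg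
  set ρ := G.dartRev with hρ
  have hall : ∀ d, d ≠ p → d ≠ ρ p → ∃ d' ∈ t ⁻¹' A, (ν * ρ).SameCycle d d' := by
    intro d hd1 hd2
    by_cases hd : t d ∈ A
    · exact ⟨d, hd, .rfl⟩
    · have : t (ρ d) ∈ A := by
        refine (hmem _).resolve_right fun h => ?_
        rcases eq_or_eq_dartRev (Subtype.ext
          (hJ _ _ _ (ht.isLink d) ((hmem d).resolve_left hd) h)) with h | h
        · exact hd1 h
        · exact hd2 h
      exact ⟨_, hν.apply_mem this, Equiv.Perm.sameCycle_apply_right.2 .rfl⟩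
  -- the darts at `x`
  have hO : {d | t d = t p}.ncard = 3 := by rw [← vertexDegree_eq_ncard ht hE, h3 _ hx]
  have hO2 : ({d | t d = t p} \ {p}).ncard = 2 := by
    rw [Set.ncard_sdiff_singleton_of_mem (by exact rfl), hO]
  obtain ⟨a, b, hab, hOab⟩ := Set.ncard_eq_two.1 hO2
  have ha : a ∈ {d | t d = t p} \ {p} := by rw [hOab]; simp
  have hb : b ∈ {d | t d = t p} \ {p} := by rw [hOab]; simp
  have haA : a ∉ t ⁻¹' A := fun h => hnot _ hx (by rw [← show t a = t p from ha.1]; exact h)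
  have hpA : p ∉ t ⁻¹' A := hnot _ hx
  have hρpA : ρ p ∉ t ⁻¹' A := hnot _ hy
  have haρ : a ≠ ρ p := by
    rintro rfl
    exact hxy (show t (ρ p) = t p from ha.1).symm
  -- Both ends of the edge between `x` and `y` dangle, so its darts form a separate face. Joining
  -- `p` to `a` at `x` merges this face with the main one.
  have hns : ¬ (ν * ρ).SameCycle a p := by
    intro h
    obtain ⟨i, -, hi⟩ := h.symm.exists_pow_eq'
    have : ∀ i : ℕ, ((ν * ρ) ^ i) p ∈ ({p, ρ p} : Set G.DartType) := by
      intro i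
      induction i with
      | zero => simp
      | succ i ih =>
        rw [pow_succ', Equiv.Perm.mul_apply]
        rcases ih with h | h
        · rw [h, Equiv.Perm.mul_apply, hν.apply_eq_self hρpA]
          simp
        · rw [h, Equiv.Perm.mul_apply, dartRev_dartRev, hν.apply_eq_self hpA]
          simp
    rcases hi ▸ this i with h | h
    · exact ha.2 h
    · exact haρ h
  have hg1 : Equiv.Perm.Glued t (insert a (t ⁻¹' A)) ν := hν.insert_free fun d hd h =>
    hnot _ hx (by rw [← show t a = t p from ha.1, ← h]; exact hd)
  have hg2 := hg1.insert_swap (a := a) (b := p) (.inl rfl)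
    (by rintro (h | h); exacts [ha.2 h.symm, hpA h]) ha.1
  have htr : ∀ d, (Equiv.swap a p * ν * ρ).SameCycle a d := by
    obtain ⟨c, hc, hac⟩ := hall a ha.2 haρ
    have hap := Equiv.Perm.sameCycle_swap_mul hns
    intro d
    rw [mul_assoc]
    by_cases hdp : d = p
    · exact hdp ▸ hap
    by_cases hdρ : d = ρ p
    · refine hap.trans (Equiv.Perm.SameCycle.swap_mul hns ?_)
      refine ⟨1, ?_⟩
      rw [zpow_one, Equiv.Perm.mul_apply, hν.apply_eq_self hρpA, hdρ]
    obtain ⟨c', hc', hdc⟩ := hall d hdp hdρ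
    exact Equiv.Perm.SameCycle.swap_mul hns (hac.trans ((hs c hc c' hc').trans hdc.symm))
  -- With one face at hand, all of `J` but `x` is glued by trivalent insertions, including the other
  -- end of the special edge.
  obtain ⟨ν', hν', hs'⟩ := hg2.exists_glue_set (fun d d' => (htr d).symm.trans (htr d'))
    (J := J \ {t p}) (hJf.subset Set.sdiff_subset)
    (fun v hv => by rw [← vertexDegree_eq_ncard ht hE, h3 v hv.1]) (by
      rintro d (rfl | rfl | hd) ⟨h, h'⟩
      · exact h' rfl
      · exact h' ha.1
      · exact hnot _ h hd)
  have hbQ : b ∉ insert p (insert a (t ⁻¹' A)) ∪ t ⁻¹' (J \ {t p}) := by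
    rintro ((h | h | h) | h)
    · exact hb.2 h
    · exact hab h.symm
    · exact hnot _ hx (by rw [← show t b = t p from hb.1]; exact h)
    · exact h.2 hb.1
  -- Only `b`, the third dart at `x`, still dangles; gluing it splits the single face into at most
  -- two.
  have hg3 := hν'.insert_swap (a := p) (b := b) (.inl (.inl rfl)) hbQ
    (show t b = t p from hb.1).symm
  obtain ⟨R, hR⟩ := exists_rotationSystem ht hg3 (by
    intro d
    by_cases hd : t d = t p
    · by_cases hdp : d = p
      · exact .inr (.inl (.inl hdp))
      have : d ∈ ({a, b} : Set G.DartType) := by rw [← hOab]; exact ⟨hd, hdp⟩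
      rcases this with h | h
      · exact .inr (.inl (.inr (.inl h)))
      · exact .inl h
    · rcases hmem d with h | h
      · exact .inr (.inl (.inr (.inr h)))
      · exact .inr (.inr ⟨h, hd⟩))
  refine ⟨R, ?_⟩
  let F : Bool → Quotient (Equiv.Perm.SameCycle.setoid R.facePerm) := fun i =>
    if i then Quotient.mk _ p else Quotient.mk _ b
  have hF : Function.Surjective F := by
    intro q
    induction q using Quotient.inductionOn with
    | _ d =>
    rcases Equiv.Perm.sameCycle_or_of_swap_mul (a := p) (b := b) hs' d with h | h
    · exact ⟨true, Quotient.sound (by rw [mul_assoc] at hR; rw [hR]; exact h)⟩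
    · exact ⟨false, Quotient.sound (by rw [mul_assoc] at hR; rw [hR]; exact h)⟩
  simpa using Nat.card_le_card_of_surjective F hF

namespace RotationSystem

variable (R : G.RotationSystem)

lemma numFaces_pos (hV : G.vertexSet.Finite) (hE : G.edgeSet.Finite) (hconn : G.IsConn) :
    0 < R.numFaces := by
  have := hE.to_subtype
  rw [numFaces]
  by_cases hne : Nonempty G.DartType
  · obtain ⟨d⟩ := hne
    have : Nonempty (Quotient (Equiv.Perm.SameCycle.setoid R.facePerm)) := ⟨Quotient.mk _ d⟩
    have := Nat.card_pos (α := Quotient (Equiv.Perm.SameCycle.setoid R.facePerm))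
    omega
  · obtain ⟨v, hv⟩ := hconn.1
    have : 0 < {v ∈ G.vertexSet | ∀ e, ¬ G.Inc e v}.ncard := by
      rw [Set.ncard_pos (hV.subset fun _ h => h.1)]
      refine ⟨v, hv, fun e ⟨y, h⟩ => hne ?_⟩
      obtain ⟨d, -⟩ := R.isTail.exists_dart h
      exact ⟨d⟩
    omega

/-- An isolated vertex of a connected graph is the whole graph; there are then no dart orbits, and
the isolated vertex supplies the only face. -/
lemma numFaces_le (hconn : G.IsConn) {n : ℕ} (hn : 1 ≤ n)
    (h : Nat.card (Quotient (Equiv.Perm.SameCycle.setoid R.facePerm)) ≤ n) :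
    R.numFaces ≤ n := by
  rw [numFaces]
  by_cases hiso : ∃ v ∈ G.vertexSet, ∀ e, ¬ G.Inc e v
  · obtain ⟨v, hv, hv'⟩ := hiso
    have huniq : ∀ w ∈ G.vertexSet, w = v := by
      intro w hw
      rcases (hconn.2 v hv w hw).cases_head with h | ⟨c, ⟨e, h⟩, -⟩
      · exact h.symm
      · exact absurd ⟨c, h⟩ (hv' e)
    have hD : IsEmpty G.DartType := by
      constructor
      intro d
      refine hv' d.1 ⟨_, huniq _ (R.isTail.mem d) ▸ R.isTail.isLink d⟩
    have h1 : {v ∈ G.vertexSet | ∀ e, ¬ G.Inc e v}.ncard ≤ 1 := by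
      refine (Set.ncard_le_ncard (t := {v}) fun w hw => huniq w hw.1).trans ?_
      simp
    have h0 : Nat.card (Quotient (Equiv.Perm.SameCycle.setoid R.facePerm)) = 0 := by
      have : IsEmpty (Quotient (Equiv.Perm.SameCycle.setoid R.facePerm)) :=
        ⟨fun q => Quotient.inductionOn q fun d => hD.elim d⟩
      exact Nat.card_of_isEmpty
    omega
  · have : {v ∈ G.vertexSet | ∀ e, ¬ G.Inc e v} = ∅ := by
      ext v
      simp only [Set.mem_ofPred_eq, Set.mem_empty_iff_false, iff_false, not_and]
      exact fun hv hv' => hiso ⟨v, hv, hv'⟩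
    rw [this]
    simpa using h

lemma numFaces_le_one (hE : G.edgeSet.Finite) (hconn : G.IsConn)
    (h : ∀ d d', R.facePerm.SameCycle d d') : R.numFaces ≤ 1 := by
  have := hE.to_subtype
  refine R.numFaces_le hconn le_rfl (Finite.card_le_one_iff_subsingleton.2 ⟨fun q q' => ?_⟩)
  induction q using Quotient.inductionOn
  induction q' using Quotient.inductionOn
  exact Quotient.sound (h _ _)

end RotationSystem

end Graph

/-! ### Removable pairs and decycling partitions -/

namespace Graph

variable {α β : Type*} {G : Graph α β}

open Relation

lemma vertexDegree_eq_ncard_inc {v : α} (h : ∀ e, ¬ G.IsLoopAt e v) :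
    G.vertexDegree v = {e | G.Inc e v}.ncard := by
  have h1 : {e | G.IsLoopAt e v} = ∅ := by
    ext e
    simpa using h e
  have h2 : {e | G.IsNonloopAt e v} = {e | G.Inc e v} := by
    ext e
    simp [isNonloopAt_iff_inc_not_isLoopAt, h e]
  rw [vertexDegree, h1, h2]
  simp

lemma vertexDegree_mono {H : Graph α β} (hle : H ≤ G) (hE : G.edgeSet.Finite) (v : α) :
    H.vertexDegree v ≤ G.vertexDegree v := by
  have h1 := Set.ncard_le_ncard (s := {e | H.IsNonloopAt e v}) (t := {e | G.IsNonloopAt e v})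
    (fun e h => h.mono hle) (hE.subset fun e h => h.edge_mem)
  have h2 := Set.ncard_le_ncard (s := {e | H.IsLoopAt e v}) (t := {e | G.IsLoopAt e v})
    (fun e h => h.mono hle) (hE.subset fun e h => h.edge_mem)
  rw [vertexDegree, vertexDegree]
  omega

/-- A subgraph with the full degree at `v` contains all the edges incident with `v`. -/
lemma inc_of_vertexDegree_le {H : Graph α β} (hle : H ≤ G) (hE : G.edgeSet.Finite) {v : α}
    (h : G.vertexDegree v ≤ H.vertexDegree v) {e : β} (he : G.Inc e v) : H.Inc e v := by
  have s1 : {e | H.IsNonloopAt e v} ⊆ {e | G.IsNonloopAt e v} := fun e h => h.mono hle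
  have s2 : {e | H.IsLoopAt e v} ⊆ {e | G.IsLoopAt e v} := fun e h => h.mono hle
  have f1 : {e | G.IsNonloopAt e v}.Finite := hE.subset fun e h => h.edge_mem
  have f2 : {e | G.IsLoopAt e v}.Finite := hE.subset fun e h => h.edge_mem
  have h1 := Set.ncard_le_ncard s1 f1
  have h2 := Set.ncard_le_ncard s2 f2
  rw [vertexDegree, vertexDegree] at h
  have e1 := Set.eq_of_subset_of_ncard_le s1 (by omega) f1
  have e2 := Set.eq_of_subset_of_ncard_le s2 (by omega) f2
  rcases he.isLoopAt_or_isNonloopAt with h | h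
  · exact IsLoopAt.inc (show e ∈ {e | H.IsLoopAt e v} from e2 ▸ h)
  · exact IsNonloopAt.inc (show e ∈ {e | H.IsNonloopAt e v} from e1 ▸ h)

/-- A loop uses two of the three units of degree, which would make `g` the only way out of `x`, a
bridge. -/
lemma IsCubicGraph.not_isLoopAt (hcubic : G.IsCubicGraph) (hE : G.edgeSet.Finite) {g : β}
    {x y : α} (hg : G.IsLink g x y) (hxy : x ≠ y) (hb : ¬ G.IsBridge g) (f : β) :
    ¬ G.IsLoopAt f x := by
  intro hf
  have hdeg := hcubic x hg.left_mem
  have h1 : 0 < {e | G.IsLoopAt e x}.ncard :=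
    (Set.ncard_pos (hE.subset fun e h => IsLoopAt.edge_mem h)).2 ⟨f, hf⟩
  have hone : {e | G.IsNonloopAt e x}.ncard ≤ 1 := by
    rw [vertexDegree] at hdeg
    omega
  have hfin : {e | G.IsNonloopAt e x}.Finite := hE.subset fun e h => IsNonloopAt.edge_mem h
  rw [Set.ncard_le_one hfin] at hone
  refine hb ⟨x, y, hg, fun h => ?_⟩
  obtain ⟨a, rfl, b, hbx, e, he, heg⟩ := exists_crossing (S := {x}) h rfl (by simpa using hxy.symm)
  exact heg (hone e ⟨b, hbx, he⟩ g ⟨y, hxy.symm, hg⟩)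

/-- From 3n = 2m one gets n = 2k and m = 3k, so that n + m = 5k is even exactly when k is. -/
lemma IsCubicGraph.four_dvd_iff (hcubic : G.IsCubicGraph) (hV : G.vertexSet.Finite)
    (hE : G.edgeSet.Finite) :
    4 ∣ G.vertexSet.ncard ↔ Even (G.vertexSet.ncard + G.edgeSet.ncard) := by
  have := hcubic.three_mul_ncard hV hE
  rw [Nat.even_iff]
  omega

lemma induce_deleteVerts {X A : Set α} (h : A ⊆ G.vertexSet \ X) :
    (G.deleteVerts X).induce A = G.induce A := by
  refine Graph.ext rfl fun e x y => ?_
  constructor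
  · rintro ⟨h1, h2⟩
    exact ⟨h1.mono deleteVerts_le, h2⟩
  · rintro ⟨h1, h2, h3⟩
    exact ⟨(deleteVerts_isLink ..).2 ⟨h1, (h h2).2, (h h3).2⟩, h2, h3⟩

/-- Deleting a removable pair from a two-face-embeddable cubic graph leaves a graph with a
one-face embedding. -/
lemma IsRemovablePair.exists_one_face (hV : G.vertexSet.Finite) (hE : G.edgeSet.Finite)
    (hcubic : G.IsCubicGraph) (h4 : 4 ∣ G.vertexSet.ncard) {x y : α} (h : G.IsRemovablePair x y) :
    ∃ R : (G.deleteVerts {x, y}).RotationSystem, R.numFaces ≤ 1 := by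
  obtain ⟨hxy, ⟨g, hg, hguniq, hb⟩, hconn, R, hR⟩ := h
  refine ⟨R, ?_⟩
  have hlx := hcubic.not_isLoopAt hE hg hxy hb
  have hly := hcubic.not_isLoopAt hE hg.symm hxy.symm hb
  have hdx := hcubic x hg.left_mem
  have hdy := hcubic y hg.right_mem
  rw [vertexDegree_eq_ncard_inc hlx] at hdx
  rw [vertexDegree_eq_ncard_inc hly] at hdy
  have fx : {e | G.Inc e x}.Finite := hE.subset fun e h => h.edge_mem
  have fy : {e | G.Inc e y}.Finite := hE.subset fun e h => h.edge_mem
  have hinter : {e | G.Inc e x} ∩ {e | G.Inc e y} = {g} := by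
    ext e
    constructor
    · rintro ⟨⟨z, hz⟩, hy⟩
      rcases hy.eq_or_eq_of_isLink hz with h | h
      · exact absurd h.symm hxy
      · exact hguniq e (h ▸ hz)
    · rintro rfl
      exact ⟨hg.inc_left, hg.inc_right⟩
  have hunion := Set.ncard_union_add_ncard_inter {e | G.Inc e x} {e | G.Inc e y} fx fy
  rw [hinter, Set.ncard_singleton, hdx, hdy] at hunion
  have hHE : (G.deleteVerts {x, y}).edgeSet.Finite := hE.subset deleteVerts_le.edgeSet_mono
  have hsplit : G.edgeSet =
      (G.deleteVerts {x, y}).edgeSet ∪ ({e | G.Inc e x} ∪ {e | G.Inc e y}) := by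
    ext e
    constructor
    · intro he
      obtain ⟨u, v, huv⟩ := exists_isLink_of_mem_edgeSet he
      by_cases hx : G.Inc e x
      · exact .inr (.inl hx)
      by_cases hy : G.Inc e y
      · exact .inr (.inr hy)
      refine .inl (IsLink.edge_mem (x := u) (y := v) ((deleteVerts_isLink ..).2 ⟨huv, ?_, ?_⟩))
      · rintro (rfl | rfl)
        exacts [hx huv.inc_left, hy huv.inc_left]
      · rintro (rfl | rfl)
        exacts [hx huv.inc_right, hy huv.inc_right]
    · rintro (h | h | h)
      exacts [deleteVerts_le.edgeSet_mono h, h.edge_mem, h.edge_mem]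
  have hdisj : Disjoint (G.deleteVerts {x, y}).edgeSet ({e | G.Inc e x} ∪ {e | G.Inc e y}) := by
    rw [Set.disjoint_left]
    intro e he h
    obtain ⟨u, v, huv⟩ := exists_isLink_of_mem_edgeSet he
    obtain ⟨huv, hu, hv⟩ := (deleteVerts_isLink ..).1 huv
    rcases h with h | h
    · rcases Inc.eq_or_eq_of_isLink h huv with rfl | rfl
      exacts [hu (.inl rfl), hv (.inl rfl)]
    · rcases Inc.eq_or_eq_of_isLink h huv with rfl | rfl
      exacts [hu (.inr rfl), hv (.inr rfl)]
  -- Three edges at each of `x` and `y`, with `g` counted twice. The parity of n + m thus changes to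
  -- odd, which forbids two faces.
  have hm : G.edgeSet.ncard = (G.deleteVerts {x, y}).edgeSet.ncard + 5 := by
    rw [hsplit, Set.ncard_union_eq hdisj hHE (fx.union fy)]
    omega
  have hsub : ({x, y} : Set α) ⊆ G.vertexSet := by
    rintro z (rfl | rfl)
    exacts [hg.left_mem, hg.right_mem]
  have hn : (G.deleteVerts {x, y}).vertexSet.ncard + 2 = G.vertexSet.ncard := by
    rw [vertexSet_deleteVerts, ← Set.ncard_pair hxy, Set.ncard_sdiff_add_ncard_of_subset hsub hV]
  have h1 := R.even_numFaces (hV.subset deleteVerts_le.vertexSet_mono) hHE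
  have h2 := (hcubic.four_dvd_iff hV hE).1 h4
  rw [Nat.even_iff] at h1 h2
  omega

lemma IsAmplyTwoFaceEmbeddable.exists_partition (hV : G.vertexSet.Finite) (hE : G.edgeSet.Finite)
    (hcubic : G.IsCubicGraph) (h : G.IsAmplyTwoFaceEmbeddable) :
    G.Loopless ∧ 4 ∣ G.vertexSet.ncard ∧
      ∃ A J : Set α, G.IsCoherentDecyclingPartition A J := by
  obtain ⟨⟨-, R₀, hR₀⟩, x, y, hpair⟩ := h
  have h4 : 4 ∣ G.vertexSet.ncard := by
    have := R₀.even_numFaces hV hE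
    rw [hcubic.four_dvd_iff hV hE]
    rw [Nat.even_iff] at this ⊢
    omega
  obtain ⟨R, hR⟩ := hpair.exists_one_face hV hE hcubic h4
  obtain ⟨hxy, ⟨g, hg, hguniq, hb⟩, hconn, -⟩ := hpair
  have hlx := hcubic.not_isLoopAt hE hg hxy hb
  have hly := hcubic.not_isLoopAt hE hg.symm hxy.symm hb
  have hHE : (G.deleteVerts {x, y}).edgeSet.Finite := hE.subset deleteVerts_le.edgeSet_mono
  obtain ⟨J, hJV, hJ3, hJind, hT⟩ := R.exists_induced_tree hHE hconn hR fun v hv =>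
    (vertexDegree_mono deleteVerts_le hE v).trans
      (hcubic v (deleteVerts_le.vertexSet_mono hv)).le
  rw [vertexSet_deleteVerts] at hT hJV
  rw [induce_deleteVerts Set.sdiff_subset] at hT
  -- A vertex of `J` has full degree already in `G - {x, y}`, so none of its edges leads to the
  -- pair.
  have hxnot : ∀ e v, v ∈ J → ¬ (G.IsLink e v x ∨ G.IsLink e v y) := by
    intro e v hv h
    have hinc : G.Inc e v := by
      rcases h with h | h
      exacts [h.inc_left, h.inc_left]
    have := inc_of_vertexDegree_le deleteVerts_le hE
      (by rw [hJ3 v hv, hcubic v (hJV hv).1]) hinc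
    obtain ⟨w, hw⟩ := this
    obtain ⟨hw, -, hw'⟩ := (deleteVerts_isLink ..).1 hw
    rcases h with h | h
    · exact hw' (.inl (hw.right_unique h))
    · exact hw' (.inr (hw.right_unique h))
  have hedge : ∀ e u v, G.IsLink e u v → u ∈ J ∪ {x, y} → v ∈ J ∪ {x, y} → e = g := by
    rintro e u v h (hu | rfl | rfl) (hv | rfl | rfl)
    · exact absurd hv (hJind e u v ((deleteVerts_isLink ..).2 ⟨h, (hJV hu).2, (hJV hv).2⟩) hu)
    · exact absurd (.inl h) (hxnot e u hu)
    · exact absurd (.inr h) (hxnot e u hu)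
    · exact absurd (.inl h.symm) (hxnot e v hv)
    · exact absurd h (hlx e)
    · exact hguniq e h
    · exact absurd (.inr h.symm) (hxnot e v hv)
    · exact hguniq e h.symm
    · exact absurd h (hly e)
  have hxyV : ({x, y} : Set α) ⊆ G.vertexSet := by
    rintro z (rfl | rfl)
    exacts [hg.left_mem, hg.right_mem]
  have hpart : (G.vertexSet \ {x, y}) \ J ∪ (J ∪ {x, y}) = G.vertexSet := by
    ext v
    constructor
    · rintro (h | h | h)
      exacts [h.1.1, (hJV h).1, hxyV h]
    · intro hv
      by_cases h1 : v ∈ ({x, y} : Set α)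
      · exact .inr (.inr h1)
      by_cases h2 : v ∈ J
      · exact .inr (.inl h2)
      exact .inl ⟨⟨hv, h1⟩, h2⟩
  refine ⟨⟨fun e v hl => ?_⟩, h4, _, _, hpart, ?_, hT, .inr ?_⟩
  · have hv : v ∈ (G.vertexSet \ {x, y}) \ J ∪ (J ∪ {x, y}) := by
      rw [hpart]
      exact IsLoopAt.vertex_mem hl
    rcases hv with hv | hv
    · exact hT.ne_of_isLink (x := v) (y := v) ⟨hl, hv, hv⟩ rfl
    · obtain rfl := hedge e v v hl hv hv
      rcases hl.eq_and_eq_or_eq_and_eq hg with ⟨h, h'⟩ | ⟨h, h'⟩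
      exacts [hxy (h.symm.trans h'), hxy (h'.symm.trans h)]
  · rw [Set.disjoint_left]
    rintro v ⟨⟨-, h1⟩, h2⟩ (h | h)
    exacts [h2 h, h1 h]
  · rw [IsNearIndepVertexSet, Set.ncard_eq_one]
    refine ⟨g, Set.ext fun e => ⟨?_, ?_⟩⟩
    · rintro ⟨u, v, h, hu, hv⟩
      exact hedge e u v h hu hv
    · rintro rfl
      exact ⟨x, y, hg, .inr (.inl rfl), .inr (.inr rfl)⟩

/-- The decomposition behind a coherent decycling partition of a cubic graph whose order is
divisible by four. -/
structure NearIndepPartition (G : Graph α β) (A J : Set α) (g : β) (x y : α) : Prop where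
  union_eq : A ∪ J = G.vertexSet
  disjoint : Disjoint A J
  tree : (G.induce A).IsTreeGraph
  isLink : G.IsLink g x y
  ne : x ≠ y
  left_mem : x ∈ J
  right_mem : y ∈ J
  eq_of_isLink : ∀ e u v, G.IsLink e u v → u ∈ J → v ∈ J → e = g

/-- An independent `J` would give a one-face embedding, while the order being divisible by 4 forces
an even number of faces. -/
lemma IsCoherentDecyclingPartition.nearIndep (hV : G.vertexSet.Finite) (hE : G.edgeSet.Finite)
    (hconn : G.IsConn) (hcubic : G.IsCubicGraph) (hloop : G.Loopless)
    (h4 : 4 ∣ G.vertexSet.ncard) {A J : Set α} (h : G.IsCoherentDecyclingPartition A J) :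
    ∃ g x y, G.NearIndepPartition A J g x y := by
  obtain ⟨hAJ, hdisj, hT, hJ | hJ⟩ := h
  · obtain ⟨R, hR⟩ := exists_rotationSystem_of_indep hV hE hAJ hdisj hT
      (fun v hv => hcubic v (hAJ ▸ .inr hv))
      (fun e x y h hx hy => by
        have : e ∈ (G.induce J).edgeSet := ⟨x, y, h, hx, hy⟩
        rw [hJ] at this
        exact this)
    have h1 := R.numFaces_le_one hE hconn hR
    have h2 := R.numFaces_pos hV hE hconn
    have h3 := R.even_numFaces hV hE
    rw [hcubic.four_dvd_iff hV hE] at h4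
    rw [Nat.even_iff] at h3 h4
    omega
  · obtain ⟨g, hg⟩ := Set.ncard_eq_one.1 hJ
    obtain ⟨x, y, hxy, hx, hy⟩ : g ∈ (G.induce J).edgeSet := by rw [hg]; rfl
    refine ⟨g, x, y, hAJ, hdisj, hT, hxy, ?_, hx, hy, fun e u v h hu hv => ?_⟩
    · rintro rfl
      exact hloop.not_isLoopAt g x hxy
    · have : e ∈ (G.induce J).edgeSet := ⟨u, v, h, hu, hv⟩
      rwa [hg] at this

namespace NearIndepPartition

variable {A J : Set α} {g : β} {x y : α}

lemma symm (h : G.NearIndepPartition A J g x y) : G.NearIndepPartition A J g y x :=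
  ⟨h.union_eq, h.disjoint, h.tree, h.isLink.symm, h.ne.symm, h.right_mem, h.left_mem,
    h.eq_of_isLink⟩

lemma not_mem (h : G.NearIndepPartition A J g x y) {v : α} (hv : v ∈ J) : v ∉ A :=
  fun h' => Set.disjoint_left.1 h.disjoint h' hv

lemma subset_left (h : G.NearIndepPartition A J g x y) : A ⊆ G.vertexSet :=
  h.union_eq ▸ Set.subset_union_left

lemma subset_right (h : G.NearIndepPartition A J g x y) : J ⊆ G.vertexSet :=
  h.union_eq ▸ Set.subset_union_right

lemma mem_of_isLink (h : G.NearIndepPartition A J g x y) {e : β} {u v : α}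
    (hl : G.IsLink e u v) (hu : u ∈ J) (he : e ≠ g) : v ∈ A := by
  have hv := hl.right_mem
  rw [← h.union_eq] at hv
  exact hv.resolve_right fun hv => he (h.eq_of_isLink e u v hl hu hv)

lemma exists_two_face (h : G.NearIndepPartition A J g x y) (hV : G.vertexSet.Finite)
    (hE : G.edgeSet.Finite) (hconn : G.IsConn) (hcubic : G.IsCubicGraph)
    (h4 : 4 ∣ G.vertexSet.ncard) : ∃ R : G.RotationSystem, R.numFaces = 2 := by
  obtain ⟨R, hR⟩ := exists_rotationSystem_of_near_indep hV hE h.union_eq h.disjoint h.tree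
    (fun v hv => hcubic v (h.subset_right hv)) h.isLink h.ne h.left_mem h.right_mem h.eq_of_isLink
  have h1 := R.numFaces_le hconn one_le_two hR
  have h2 := R.numFaces_pos hV hE hconn
  have h3 := R.even_numFaces hV hE
  rw [hcubic.four_dvd_iff hV hE] at h4
  refine ⟨R, ?_⟩
  rw [Nat.even_iff] at h3 h4
  omega

/-- A vertex of `J` has two edges that lead to `A`. -/
lemma exists_link_ne (h : G.NearIndepPartition A J g x y)
    (hcubic : G.IsCubicGraph) (hloop : G.Loopless) {v : α} (hv : v ∈ J) :
    ∃ e a, a ∈ A ∧ G.IsLink e v a ∧ e ≠ g := by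
  have hdeg := hcubic v (h.subset_right hv)
  rw [vertexDegree_eq_ncard_inc (hloop.not_isLoopAt · v)] at hdeg
  obtain ⟨e, he, hne⟩ := Set.exists_ne_of_one_lt_ncard (s := {e | G.Inc e v}) (by omega) g
  obtain ⟨a, ha⟩ := he
  exact ⟨e, a, h.mem_of_isLink ha hv hne, ha, hne⟩

lemma not_isBridge (h : G.NearIndepPartition A J g x y)
    (hcubic : G.IsCubicGraph) (hloop : G.Loopless) : ¬ G.IsBridge g := by
  intro hb
  obtain ⟨e, a, ha, hea, heg⟩ := h.exists_link_ne hcubic hloop h.left_mem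
  obtain ⟨f, b, hb', hfb, hfg⟩ := h.exists_link_ne hcubic hloop h.right_mem
  -- The detour around `g` goes from `x` into the tree on `A`, through it, and back to `y`.
  refine hb.not_reach h.isLink (.head (b := a) ⟨e, hea, heg⟩ (.tail (b := b) ?_
    ⟨f, hfb.symm, hfg⟩))
  refine reach_of_imp ?_ (h.tree.1.2 a ha b hb')
  rintro u v ⟨e', hl, hu, hv⟩
  refine ⟨e', hl, ?_⟩
  rintro rfl
  rcases hl.eq_and_eq_or_eq_and_eq h.isLink with ⟨rfl, -⟩ | ⟨rfl, -⟩
  exacts [h.not_mem h.left_mem hu, h.not_mem h.right_mem hu]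

/-- Without `x` and `y` the rest of `J` is independent and keeps its full degree, so that `G - {x,
y}` even has a one-face embedding. -/
lemma isUpperEmbeddable (h : G.NearIndepPartition A J g x y) (hV : G.vertexSet.Finite)
    (hE : G.edgeSet.Finite) (hcubic : G.IsCubicGraph) (hloop : G.Loopless) :
    (G.deleteVerts {x, y}).IsUpperEmbeddable := by
  have hAsub : A ⊆ G.vertexSet \ {x, y} := by
    intro a ha
    refine ⟨h.subset_left ha, ?_⟩
    rintro (rfl | rfl)
    exacts [h.not_mem h.left_mem ha, h.not_mem h.right_mem ha]
  have hlink : ∀ v ∈ J \ {x, y}, ∀ e w, G.IsLink e v w → w ∈ A := by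
    rintro v ⟨hv, hvxy⟩ e w hl
    refine h.mem_of_isLink hl hv ?_
    rintro rfl
    rcases hl.eq_and_eq_or_eq_and_eq h.isLink with ⟨rfl, -⟩ | ⟨rfl, -⟩
    exacts [hvxy (.inl rfl), hvxy (.inr rfl)]
  have hHlink : ∀ v ∈ J \ {x, y}, ∀ e w, G.IsLink e v w →
      (G.deleteVerts {x, y}).IsLink e v w := fun v hv e w hl =>
    (deleteVerts_isLink ..).2 ⟨hl, hv.2, (hAsub (hlink v hv e w hl)).2⟩
  have hAJ : A ∪ J \ {x, y} = (G.deleteVerts {x, y}).vertexSet := by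
    rw [vertexSet_deleteVerts, ← h.union_eq, Set.union_sdiff_distrib]
    congr 1
    exact (sdiff_eq_left.2 (Set.disjoint_left.2 fun a ha => (hAsub ha).2)).symm
  have hT : ((G.deleteVerts {x, y}).induce A).IsTreeGraph := by
    rw [induce_deleteVerts hAsub]
    exact h.tree
  have hHE : (G.deleteVerts {x, y}).edgeSet.Finite := hE.subset deleteVerts_le.edgeSet_mono
  have hHV : (G.deleteVerts {x, y}).vertexSet.Finite := hV.subset deleteVerts_le.vertexSet_mono
  have hdeg : ∀ v ∈ J \ {x, y}, (G.deleteVerts {x, y}).vertexDegree v = 3 := by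
    intro v hv
    have hl := fun e => hloop.not_isLoopAt e v
    rw [← hcubic v (h.subset_right hv.1), vertexDegree_eq_ncard_inc hl,
      vertexDegree_eq_ncard_inc fun e he => hl e (he.mono deleteVerts_le)]
    congr 1
    ext e
    exact ⟨fun he => he.mono deleteVerts_le, fun ⟨w, hw⟩ => ⟨w, hHlink v hv e w hw⟩⟩
  have hconn : (G.deleteVerts {x, y}).IsConn := by
    obtain ⟨r, hr⟩ := h.tree.1.1
    have hA : ∀ a ∈ A, ReflTransGen (G.deleteVerts {x, y}).Adj r a := fun a ha =>
      reach_mono (induce_le (hAJ ▸ Set.subset_union_left)) (hT.1.2 r hr a ha)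
    have hall : ∀ v ∈ (G.deleteVerts {x, y}).vertexSet,
        ReflTransGen (G.deleteVerts {x, y}).Adj r v := by
      intro v hv
      rw [← hAJ] at hv
      rcases hv with hv | hv
      · exact hA v hv
      · obtain ⟨e, a, ha, hl, -⟩ := h.exists_link_ne hcubic hloop hv.1
        exact (hA a ha).tail ⟨e, (hHlink v hv e a hl).symm⟩
    exact ⟨⟨r, hAJ ▸ .inl hr⟩, fun u hu v hv => (reach_symm (hall u hu)).trans (hall v hv)⟩
  obtain ⟨R, hR⟩ := exists_rotationSystem_of_indep hHV hHE hAJ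
    (h.disjoint.mono_right Set.sdiff_subset) hT hdeg
    (fun e u v hl hu hv => h.not_mem hv.1 (hlink u hu e v (hl.mono deleteVerts_le)))
  exact ⟨hconn, R, (R.numFaces_le_one hHE hconn hR).trans one_le_two⟩

lemma isAmplyTwoFaceEmbeddable (h : G.NearIndepPartition A J g x y) (hV : G.vertexSet.Finite)
    (hE : G.edgeSet.Finite) (hconn : G.IsConn) (hcubic : G.IsCubicGraph) (hloop : G.Loopless)
    (h4 : 4 ∣ G.vertexSet.ncard) : G.IsAmplyTwoFaceEmbeddable :=
  ⟨⟨hconn, h.exists_two_face hV hE hconn hcubic h4⟩, x, y, h.ne,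
    ⟨g, h.isLink, fun f hf => h.eq_of_isLink f x y hf h.left_mem h.right_mem,
      h.not_isBridge hcubic hloop⟩, h.isUpperEmbeddable hV hE hcubic hloop⟩

end NearIndepPartition

/-- By parity m - n = 2k, so two faces give genus k, and genus above k would leave no face at all.
-/
lemma deficiency_eq_one (hV : G.vertexSet.Finite) (hE : G.edgeSet.Finite)
    (hconn : G.IsConn) (hcubic : G.IsCubicGraph) {R : G.RotationSystem} (hR : R.numFaces = 2) :
    G.deficiency = 1 := by
  have h2 := R.even_numFaces hV hE
  have h3 := hcubic.three_mul_ncard hV hE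
  obtain ⟨k, hk⟩ : ∃ k, G.edgeSet.ncard = G.vertexSet.ncard + 2 * k := by
    rw [Nat.even_iff] at h2
    exact ⟨(G.edgeSet.ncard - G.vertexSet.ncard) / 2, by omega⟩
  have hmem : k ∈ {g : ℕ | ∃ R : G.RotationSystem, R.HasGenus g} := by
    refine ⟨R, ?_⟩
    rw [RotationSystem.HasGenus, hR, hk]
    push_cast
    ring
  have hub : ∀ g ∈ {g : ℕ | ∃ R : G.RotationSystem, R.HasGenus g}, g ≤ k := by
    rintro g ⟨R', hR'⟩
    have := R'.numFaces_pos hV hE hconn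
    rw [RotationSystem.HasGenus] at hR'
    omega
  have hmax : G.maxGenus = k :=
    le_antisymm (csSup_le ⟨k, hmem⟩ hub) (le_csSup ⟨k, hub⟩ hmem)
  rw [deficiency, bettiNumber, hmax, hk]
  push_cast
  ring

end Graph

/-! ### Components, and assignments of edges to ends with given parities -/

namespace Graph

variable {α β : Type*} {G : Graph α β}

open Relation

/-- The connected component of `v`. -/
def componentOf (G : Graph α β) (v : α) : Graph α β := G.induce {w | ReflTransGen G.Adj v w}

lemma componentOf_reach_subset {v : α} (hv : v ∈ G.vertexSet) :
    {w | ReflTransGen G.Adj v w} ⊆ G.vertexSet := by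
  intro w hw
  rcases hw.cases_tail with h | ⟨c, -, h⟩
  · exact h ▸ hv
  · exact h.right_mem

lemma mem_edgeSet_componentOf {v : α} {e : β} {x : α} (he : G.Inc e x) :
    e ∈ (G.componentOf v).edgeSet ↔ ReflTransGen G.Adj v x := by
  constructor
  · rintro ⟨p, q, h, hp, hq⟩
    rcases he.eq_or_eq_of_isLink h with rfl | rfl
    exacts [hp, hq]
  · intro hx
    obtain ⟨y, hy⟩ := he
    exact ⟨x, y, hy, hx, hx.tail ⟨e, hy⟩⟩

lemma isComponent_componentOf {v : α} (hv : v ∈ G.vertexSet) :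
    (G.componentOf v).IsComponent G := by
  refine ⟨IsClosedSubgraph.mk' (induce_le (componentOf_reach_subset hv))
    fun e x he hx => (mem_edgeSet_componentOf he).2 hx, ⟨v, .refl⟩, ?_⟩
  have key : ∀ w, ReflTransGen G.Adj v w → ReflTransGen (G.componentOf v).Adj v w := by
    intro w hw
    induction hw with
    | refl => exact .refl
    | tail hb h ih =>
      obtain ⟨e, h⟩ := h
      exact ih.tail ⟨e, h, hb, hb.tail ⟨e, h⟩⟩
  exact fun x hx y hy => (reach_symm (key x hx)).trans (key y hy)

lemma IsComponent.eq_componentOf {K : Graph α β} (hK : K.IsComponent G) {v : α}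
    (hv : v ∈ K.vertexSet) : K = G.componentOf v := by
  have hV : K.vertexSet = {w | ReflTransGen G.Adj v w} := by
    ext w
    constructor
    · exact fun hw => reach_mono hK.1.le (hK.2.2 v hv w hw)
    · intro hw
      induction hw with
      | refl => exact hv
      | tail _ h ih => exact (hK.1.mem_iff_of_adj h).1 ih
  refine Graph.ext hV fun e x y => ?_
  constructor
  · intro h
    exact ⟨h.mono hK.1.le, hV ▸ h.left_mem, hV ▸ h.right_mem⟩
  · rintro ⟨h, hx, -⟩
    exact (hK.1.isLink_congr (hV ▸ hx)).2 h

section Orientation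

variable [DecidableEq α]

/-- Reversing the edges of a walk changes the parities of the indegrees exactly at its ends. -/
lemma exists_reassign {E : Finset β} (hE : (E : Set β) = G.edgeSet) {v w : α}
    (h : ReflTransGen G.Adj v w) {s : β → α} (hs : ∀ e ∈ E, G.Inc e (s e)) :
    ∃ s' : β → α, (∀ e ∈ E, G.Inc e (s' e)) ∧ ∀ a,
      (∑ e ∈ E, if s' e = a then (1 : ZMod 2) else 0) =
        (∑ e ∈ E, if s e = a then (1 : ZMod 2) else 0) +
          (if v = a then 1 else 0) + (if w = a then 1 else 0) := by
  classical
  have two : ∀ c : ZMod 2, c + c = 0 := by decide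
  induction h with
  | refl =>
    refine ⟨s, hs, fun a => ?_⟩
    rw [add_assoc, two, add_zero]
  | @tail b c _ hbc ih =>
    obtain ⟨s', hs', hsum⟩ := ih
    obtain ⟨f, hf⟩ := hbc
    have hfE : f ∈ E := by
      rw [← Finset.mem_coe, hE]
      exact hf.edge_mem
    -- The last edge of the walk is handed over to its other end, which changes the parities at just
    -- `b` and `c`.
    obtain ⟨d, hd, hdsum⟩ : ∃ d, G.Inc f d ∧ ∀ a, (if d = a then (1 : ZMod 2) else 0) =
        (if s' f = a then 1 else 0) + (if b = a then 1 else 0) + (if c = a then 1 else 0) := by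
      rcases (hs' f hfE).eq_or_eq_of_isLink hf with h | h
      · refine ⟨c, hf.inc_right, fun a => ?_⟩
        rw [h, two, zero_add]
      · refine ⟨b, hf.inc_left, fun a => ?_⟩
        rw [h, add_right_comm, two, zero_add]
    refine ⟨Function.update s' f d, ?_, fun a => ?_⟩
    · intro e he
      by_cases hef : e = f
      · rw [hef, Function.update_self]
        exact hd
      · rw [Function.update_of_ne hef]
        exact hs' e he
    · have h1 : (∑ e ∈ E.erase f, if Function.update s' f d e = a then (1 : ZMod 2) else 0) =
          ∑ e ∈ E.erase f, if s' e = a then (1 : ZMod 2) else 0 := by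
        refine Finset.sum_congr rfl fun e he => ?_
        rw [Function.update_of_ne (Finset.ne_of_mem_erase he)]
      have h2 := hsum a
      rw [← Finset.add_sum_erase E _ hfE] at h2
      rw [← Finset.add_sum_erase E _ hfE, h1, Function.update_self, hdsum a]
      linear_combination (exp := 1) h2 + two (if b = a then (1 : ZMod 2) else 0)

/-- The edges of a finite graph can be assigned to their ends with prescribed parities, provided
that the prescription is consistent with the number of edges of each component. -/
lemma exists_assignment [Nonempty α] {V : Finset α} {E : Finset β} (hV : (V : Set α) = G.vertexSet)
    (hE : (E : Set β) = G.edgeSet) (b : α → ZMod 2)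
    (hb : ∀ v ∈ V, ∀ X : Finset α, (X : Set α) = {w | ReflTransGen G.Adj v w} →
      ∑ a ∈ X, b a = ((G.componentOf v).edgeSet.ncard : ZMod 2)) :
    ∃ s : β → α, (∀ e ∈ E, G.Inc e (s e)) ∧
      ∀ a ∈ V, (∑ e ∈ E, if s e = a then (1 : ZMod 2) else 0) = b a := by
  classical
  have two : ∀ c : ZMod 2, c + c = 0 := by decide
  have hone : ∀ c : ZMod 2, c ≠ 0 → c = 1 := by decide
  -- The discrepancy at each vertex; an assignment with the fewest nonzero discrepancies is taken.
  let q : (β → α) → α → ZMod 2 := fun s a =>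
    (∑ e ∈ E, if s e = a then (1 : ZMod 2) else 0) + b a
  let P : ℕ → Prop := fun n => ∃ s : β → α, (∀ e ∈ E, G.Inc e (s e)) ∧
    {a ∈ V | q s a ≠ 0}.card = n
  have hP : ∃ n, P n := by
    have : ∀ e ∈ E, ∃ x, G.Inc e x := by
      intro e he
      rw [← Finset.mem_coe, hE] at he
      obtain ⟨x, y, h⟩ := exists_isLink_of_mem_edgeSet he
      exact ⟨x, y, h⟩
    have : ∀ e, ∃ x, e ∈ E → G.Inc e x := by
      intro e
      by_cases he : e ∈ E
      · obtain ⟨x, hx⟩ := this e he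
        exact ⟨x, fun _ => hx⟩
      · exact ⟨Classical.arbitrary α, fun h => absurd h he⟩
    choose s hs using this
    exact ⟨_, s, hs, rfl⟩
  obtain ⟨s, hs, hn⟩ := Nat.find_spec hP
  refine ⟨s, hs, fun v hv => ?_⟩
  by_contra hcon
  have hqv : q s v ≠ 0 := by
    intro h
    apply hcon
    have : b v + b v = 0 := two _
    linear_combination (exp := 1) h - this
  have hvG : v ∈ G.vertexSet := by rw [← hV]; exact hv
  have hsub := componentOf_reach_subset hvG
  have hXf : {w | ReflTransGen G.Adj v w}.Finite := by
    refine Set.Finite.subset ?_ hsub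
    rw [← hV]
    exact V.finite_toSet
  set X := hXf.toFinset with hX
  have hmemX : ∀ a, a ∈ X ↔ ReflTransGen G.Adj v a := fun a => by simp [hX]
  have hXV : X ⊆ V := by
    intro a ha
    rw [← Finset.mem_coe, hV]
    exact hsub ((hmemX a).1 ha)
  have hsumq : ∑ a ∈ X, q s a = 0 := by
    have hsum : ∑ a ∈ X, ∑ e ∈ E, (if s e = a then (1 : ZMod 2) else 0) =
        ((G.componentOf v).edgeSet.ncard : ZMod 2) := by
      rw [Finset.sum_comm]
      have h1 : ∀ e ∈ E, (∑ a ∈ X, if s e = a then (1 : ZMod 2) else 0) =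
          if e ∈ (G.componentOf v).edgeSet then 1 else 0 := by
        intro e he
        rw [Finset.sum_ite_eq]
        simp only [hmemX, mem_edgeSet_componentOf (hs e he)]
      rw [Finset.sum_congr rfl h1, Finset.sum_boole]
      congr 1
      rw [← Set.ncard_coe_finset]
      congr 1
      ext e
      simp only [Finset.coe_filter, Set.mem_ofPred_eq, and_iff_right_iff_imp]
      intro he
      rw [← Finset.mem_coe, hE]
      exact (isComponent_componentOf hvG).1.le.edgeSet_mono he
    rw [Finset.sum_add_distrib, hsum, hb v hv X (by simp [hX]), two]
  -- The discrepancies in a component add up to zero, so a bad vertex has a bad partner there;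
  -- reversing a walk between them repairs both.
  obtain ⟨w, hwX, hwv, hqw⟩ : ∃ w ∈ X, w ≠ v ∧ q s w ≠ 0 := by
    by_contra! h
    apply hqv
    rw [← hsumq]
    exact (Finset.sum_eq_single v h fun hvX => absurd ((hmemX v).2 .refl) hvX).symm
  obtain ⟨s', hs', hsum'⟩ := exists_reassign hE ((hmemX w).1 hwX) hs
  refine Nat.find_min hP (m := {a ∈ V | q s' a ≠ 0}.card) ?_ ⟨s', hs', rfl⟩
  rw [← hn]
  have hq' : ∀ a, q s' a = q s a + (if v = a then 1 else 0) + (if w = a then 1 else 0) := by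
    intro a
    change _ + b a = (_ + b a) + _ + _
    rw [hsum' a]
    ring
  refine Finset.card_lt_card (Finset.ssubset_iff_of_subset ?_ |>.2
    ⟨v, Finset.mem_filter.2 ⟨hv, hqv⟩, ?_⟩)
  · intro a ha
    rw [Finset.mem_filter] at ha ⊢
    refine ⟨ha.1, fun h0 => ?_⟩
    by_cases hav : v = a
    · exact hqv (hav ▸ h0)
    by_cases haw : w = a
    · exact hqw (haw ▸ h0)
    apply ha.2
    rw [hq', if_neg hav, if_neg haw, h0]
    simp
  · rw [Finset.mem_filter]
    rintro ⟨-, h⟩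
    apply h
    rw [hq', if_pos rfl, if_neg hwv, hone _ hqv]
    decide

end Orientation

/-! ### From a decycling partition to a Xuong tree -/

namespace NearIndepPartition

variable {A J : Set α} {g : β} {x y : α}

/-- A spanning tree that extends `G[A]` by one edge for each vertex of `J`. -/
lemma exists_spanningTree (h : G.NearIndepPartition A J g x y)
    (hcubic : G.IsCubicGraph) (hloop : G.Loopless) :
    ∃ (f : α → β) (T : Graph α β), G.IsSpanningTree T ∧ (∀ v ∈ J, G.Inc (f v) v ∧ f v ≠ g) ∧
      ∀ e u v, T.IsLink e u v ↔ G.IsLink e u v ∧ (e ∈ (G.induce A).edgeSet ∨ ∃ w ∈ J, e = f w) := by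
  have hex : ∀ v, ∃ e a, v ∈ J → a ∈ A ∧ G.IsLink e v a ∧ e ≠ g := by
    intro v
    by_cases hv : v ∈ J
    · obtain ⟨e, a, h⟩ := h.exists_link_ne hcubic hloop hv
      exact ⟨e, a, fun _ => h⟩
    · exact ⟨g, v, fun h => absurd h hv⟩
  choose f p hfp using hex
  set F : Set β := {e | e ∈ (G.induce A).edgeSet ∨ ∃ w ∈ J, e = f w} with hF
  have hle : G.restrict F ≤ G := restrict_le
  have hTl : ∀ e u v, (G.restrict F).IsLink e u v ↔ G.IsLink e u v ∧ e ∈ F := fun e u v =>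
    ⟨fun h => ⟨h.2, h.1⟩, fun h => ⟨h.2, h.1⟩⟩
  have hmem : ∀ v ∈ G.vertexSet, v ∈ A ∨ v ∈ J := fun v hv => by rwa [← h.union_eq] at hv
  have hfl : ∀ v ∈ J, (G.restrict F).IsLink (f v) v (p v) := fun v hv =>
    (hTl _ _ _).2 ⟨(hfp v hv).2.1, .inr ⟨v, hv, rfl⟩⟩
  have hends : ∀ e ∈ (G.induce A).edgeSet, ∀ u v, G.IsLink e u v → u ∈ A ∧ v ∈ A := by
    rintro e ⟨u', v', h', hu', hv'⟩ u v hl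
    rcases hl.eq_and_eq_or_eq_and_eq h' with ⟨rfl, rfl⟩ | ⟨rfl, rfl⟩
    exacts [⟨hu', hv'⟩, ⟨hv', hu'⟩]
  refine ⟨f, G.restrict F, ⟨⟨hle, rfl⟩, ⟨?_, ?_⟩, ?_⟩,
    fun v hv => ⟨(hfp v hv).2.1.inc_left, (hfp v hv).2.2⟩, hTl⟩
  · obtain ⟨r, hr⟩ := h.tree.1.1
    exact ⟨r, h.subset_left hr⟩
  · obtain ⟨r, hr⟩ := h.tree.1.1
    have hA : ∀ a ∈ A, ReflTransGen (G.restrict F).Adj r a := fun a ha =>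
      reach_of_imp (fun u v ⟨e, he⟩ => ⟨e, (hTl _ _ _).2 ⟨he.1, .inl he.edge_mem⟩⟩)
        (h.tree.1.2 r hr a ha)
    have hall : ∀ v ∈ G.vertexSet, ReflTransGen (G.restrict F).Adj r v := by
      intro v hv
      rcases hmem v hv with hv | hv
      · exact hA v hv
      · exact (hA _ (hfp v hv).1).tail ⟨_, (hfl v hv).symm⟩
    exact fun u hu v hv => (reach_symm (hall u hu)).trans (hall v hv)
  · classical
    rintro e ⟨-, he | ⟨w, hw, rfl⟩⟩
    · obtain ⟨a, b, hab⟩ := exists_isLink_of_mem_edgeSet he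
      refine ⟨a, b, (hTl _ _ _).2 ⟨hab.1, .inl he⟩, fun hr => ?_⟩
      -- Folding each leaf onto its neighbour in `A` turns walks of the extended tree into walks of
      -- the tree on `A`.
      have hproj : ∀ u v, ReflTransGen ((G.restrict F).deleteEdges {e}).Adj u v →
          ReflTransGen ((G.induce A).deleteEdges {e}).Adj (if u ∈ J then p u else u)
            (if v ∈ J then p v else v) := by
        intro u v huv
        induction huv with
        | refl => exact .refl
        | @tail c d _ hcd ih =>
          refine ih.trans ?_
          obtain ⟨e', ⟨hl, hne⟩⟩ := hcd
          obtain ⟨hl, hF' | ⟨w, hw, rfl⟩⟩ := (hTl _ _ _).1 hl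
          · obtain ⟨hc, hd⟩ := hends _ hF' _ _ hl
            rw [if_neg fun hJ => h.not_mem hJ hc, if_neg fun hJ => h.not_mem hJ hd]
            exact .single ⟨e', ⟨hl, hc, hd⟩, hne⟩
          · have hpw : p w ∉ J := fun hJ => h.not_mem hJ (hfp w hw).1
            rcases hl.eq_and_eq_or_eq_and_eq (hfp w hw).2.1 with ⟨rfl, rfl⟩ | ⟨rfl, rfl⟩ <;>
            · rw [if_pos hw, if_neg hpw]
      have := hproj a b hr
      rw [if_neg fun hJ => h.not_mem hJ hab.2.1, if_neg fun hJ => h.not_mem hJ hab.2.2] at this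
      exact (h.tree.2 e he).not_reach hab this
    -- A leaf edge is a bridge because no other tree edge meets its end in `J`.
    · refine ⟨w, p w, hfl w hw, fun hr => ?_⟩
      have hne : p w ∉ ({w} : Set α) := by
        rintro (h' : p w = w)
        exact h.not_mem hw (h' ▸ (hfp w hw).1)
      obtain ⟨_, rfl, b, -, e', hl, hne'⟩ := exists_crossing (S := {w}) hr rfl hne
      obtain ⟨hl, hF' | ⟨w', hw', rfl⟩⟩ := (hTl _ _ _).1 hl
      · exact h.not_mem hw (hends _ hF' _ _ hl).1
      · rcases hl.left_eq_or_eq (hfp w' hw').2.1 with rfl | rfl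
        · exact hne' rfl
        · exact h.not_mem hw (hfp w' hw').1

end NearIndepPartition

end Graph

namespace Graph

variable {α β : Type*} {G : Graph α β}

open Relation

lemma cotree_inc {T : Graph α β} {e : β} {v : α} :
    (G.cotree T).Inc e v ↔ G.Inc e v ∧ e ∉ T.edgeSet :=
  ⟨fun ⟨w, h⟩ => ⟨⟨w, h.1⟩, h.2⟩, fun ⟨⟨w, h⟩, h'⟩ => ⟨w, h, h'⟩⟩

lemma cotree_le {T : Graph α β} : G.cotree T ≤ G := deleteEdges_le

namespace NearIndepPartition

variable {A J : Set α} {g : β} {x y : α} {f : α → β} {T : Graph α β}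

/-- A component of the cotree has two edges for each of its vertices in `J`, up to the edge
within `J`, which is counted twice. -/
lemma ncard_component (h : G.NearIndepPartition A J g x y) (hV : G.vertexSet.Finite)
    (hE : G.edgeSet.Finite) (hcubic : G.IsCubicGraph) (hloop : G.Loopless)
    (hf : ∀ v ∈ J, G.Inc (f v) v ∧ f v ≠ g)
    (hT : ∀ e u v, T.IsLink e u v ↔
      G.IsLink e u v ∧ (e ∈ (G.induce A).edgeSet ∨ ∃ w ∈ J, e = f w))
    {K : Graph α β} (hK : K.IsComponent (G.cotree T)) :
    (y ∈ K.vertexSet → K.edgeSet.ncard + 1 = 2 * (J ∩ K.vertexSet).ncard) ∧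
      (y ∉ K.vertexSet → K.edgeSet.ncard = 2 * (J ∩ K.vertexSet).ncard) ∧
      (G.cotree T).IsLink g x y := by
  classical
  set C := G.cotree T with hC
  have hET : ∀ e ∈ G.edgeSet,
      e ∈ T.edgeSet ↔ e ∈ (G.induce A).edgeSet ∨ ∃ w ∈ J, e = f w := by
    intro e he
    obtain ⟨u, v, huv⟩ := exists_isLink_of_mem_edgeSet he
    constructor
    · intro h'
      obtain ⟨u', v', h'⟩ := exists_isLink_of_mem_edgeSet h'
      exact ((hT _ _ _).1 h').2
    · exact fun h' => ((hT e u v).2 ⟨huv, h'⟩).edge_mem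
  have hincA : ∀ e ∈ (G.induce A).edgeSet, ∀ v, G.Inc e v → v ∈ A := by
    rintro e ⟨u', v', h', hu', hv'⟩ v hv
    rcases hv.eq_or_eq_of_isLink h' with rfl | rfl
    exacts [hu', hv']
  have hCinc : ∀ v ∈ J, ∀ e, C.Inc e v ↔ G.Inc e v ∧ e ≠ f v := by
    intro v hv e
    rw [hC, cotree_inc]
    refine and_congr_right fun he => ?_
    rw [hET e he.edge_mem, ← not_iff_not, not_not, not_not]
    constructor
    · rintro (he' | ⟨w, hw, rfl⟩)
      · exact absurd (hincA e he' v he) (h.not_mem hv)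
      · obtain ⟨u, hu⟩ := he
        rcases (hf w hw).1.eq_or_eq_of_isLink hu with rfl | rfl
        · rfl
        · exact absurd (h.eq_of_isLink _ _ _ hu hv hw) (hf w hw).2
    · exact fun h' => .inr ⟨v, hv, h'⟩
  have hD : ∀ v ∈ J, {e | C.Inc e v}.ncard = 2 := by
    intro v hv
    have hdeg := hcubic v (h.subset_right hv)
    rw [vertexDegree_eq_ncard_inc (fun e => hloop.not_isLoopAt e v)] at hdeg
    have : {e | C.Inc e v} = {e | G.Inc e v} \ {f v} := by
      ext e
      exact hCinc v hv e
    rw [this, Set.ncard_sdiff_singleton_of_mem (by exact (hf v hv).1), hdeg]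
  have hg : C.IsLink g x y := by
    refine ⟨h.isLink, fun hg => ?_⟩
    rcases (hET g h.isLink.edge_mem).1 hg with hg | ⟨w, hw, hg⟩
    · exact h.not_mem h.left_mem (hincA g hg x h.isLink.inc_left)
    · exact (hf w hw).2 hg.symm
  -- Each cotree edge is charged to an end in `J`. The choice matters only for `g`, which has two
  -- such ends and is charged to `x`.
  have hex : ∀ e, ∃ v, e ∈ C.edgeSet → v ∈ J ∧ C.Inc e v ∧ (e = g → v = x) := by
    intro e
    by_cases he : e ∈ C.edgeSet
    · obtain ⟨u, v, huv⟩ := exists_isLink_of_mem_edgeSet he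
      by_cases heg : e = g
      · exact ⟨x, fun _ => ⟨h.left_mem, heg ▸ hg.inc_left, fun _ => rfl⟩⟩
      have hmem : ∀ w, w ∈ G.vertexSet → w ∉ J → w ∈ A := fun w hw hJ => by
        rw [← h.union_eq] at hw
        exact hw.resolve_right hJ
      by_cases hu : u ∈ J
      · exact ⟨u, fun _ => ⟨hu, huv.inc_left, fun h => absurd h heg⟩⟩
      by_cases hv : v ∈ J
      · exact ⟨v, fun _ => ⟨hv, huv.inc_right, fun h => absurd h heg⟩⟩
      refine absurd ((hET e huv.1.edge_mem).2 (.inl ⟨u, v, huv.1, ?_, ?_⟩)) huv.2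
      · exact hmem u huv.1.left_mem hu
      · exact hmem v huv.1.right_mem hv
    · exact ⟨x, fun h => absurd h he⟩
  choose s hs using hex
  have hfib : ∀ v ∈ J, ∀ e ∈ C.edgeSet, s e = v ↔ C.Inc e v ∧ (v = y → e ≠ g) := by
    intro v hv e he
    obtain ⟨hsJ, hsI, hsg⟩ := hs e he
    constructor
    · rintro rfl
      exact ⟨hsI, fun hy heg => h.ne ((hsg heg).symm.trans hy)⟩
    · rintro ⟨hI, hy⟩
      by_contra hne
      obtain ⟨w, hw⟩ := hI
      have hws : s e = w := (hsI.eq_or_eq_of_isLink hw).resolve_left hne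
      have heg : e = g := h.eq_of_isLink e v w hw.1 hv (hws ▸ hsJ)
      refine hy ?_ heg
      have : v = x ∨ v = y := hw.inc_left.eq_or_eq_of_isLink (heg ▸ hg)
      exact this.resolve_left fun h' => hne ((hsg heg).trans h'.symm)
  have hCE : C.edgeSet.Finite := hE.subset cotree_le.edgeSet_mono
  have hKE : K.edgeSet.Finite := hCE.subset hK.1.le.edgeSet_mono
  have hSf : (J ∩ K.vertexSet).Finite := hV.subset fun v hv => h.subset_right hv.1
  have hKmem : ∀ e ∈ C.edgeSet, e ∈ K.edgeSet ↔ s e ∈ K.vertexSet := by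
    intro e he
    constructor
    · intro heK
      obtain ⟨u, v, huv⟩ := exists_isLink_of_mem_edgeSet heK
      rcases (hs e he).2.1.eq_or_eq_of_isLink (huv.mono hK.1.le) with h' | h'
      · exact h' ▸ huv.left_mem
      · exact h' ▸ huv.right_mem
    · exact fun h' => hK.1.closed (hs e he).2.1 h'
  -- Every vertex of `J` is charged with its two cotree edges, except that `y` loses `g`.
  have hcard : K.edgeSet.ncard = ∑ v ∈ hSf.toFinset, if v = y then 1 else 2 := by
    rw [Set.ncard_eq_toFinset_card _ hKE, Finset.card_eq_sum_card_fiberwise (f := s)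
      (t := hSf.toFinset)]
    · refine Finset.sum_congr rfl fun v hv => ?_
      obtain ⟨hvJ, hvK⟩ : v ∈ J ∧ v ∈ K.vertexSet := by simpa using hv
      rw [← Set.ncard_coe_finset]
      by_cases hvy : v = y
      · rw [if_pos hvy]
        have : ((({e ∈ hKE.toFinset | s e = v} : Finset β)) : Set β) =
            {e | C.Inc e v} \ {g} := by
          ext e
          simp only [Finset.coe_filter, Set.Finite.mem_toFinset, Set.mem_ofPred_eq, Set.mem_sdiff,
            Set.mem_singleton_iff]
          constructor
          · rintro ⟨he, hse⟩
            have := (hfib v hvJ e (hK.1.le.edgeSet_mono he)).1 hse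
            exact ⟨this.1, this.2 hvy⟩
          · rintro ⟨he, heg⟩
            have := (hfib v hvJ e he.edge_mem).2 ⟨he, fun _ => heg⟩
            exact ⟨(hKmem e he.edge_mem).2 (this ▸ hvK), this⟩
        rw [this, Set.ncard_sdiff_singleton_of_mem (by exact hvy ▸ hg.inc_right), hD v hvJ]
      · rw [if_neg hvy, ← hD v hvJ]
        congr 1
        ext e
        simp only [Finset.coe_filter, Set.Finite.mem_toFinset, Set.mem_ofPred_eq]
        constructor
        · rintro ⟨he, hse⟩
          exact ((hfib v hvJ e (hK.1.le.edgeSet_mono he)).1 hse).1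
        · intro he
          have := (hfib v hvJ e he.edge_mem).2 ⟨he, fun h' => absurd h' hvy⟩
          exact ⟨(hKmem e he.edge_mem).2 (this ▸ hvK), this⟩
    · intro e he
      have he' : e ∈ K.edgeSet := by simpa using he
      have heC := hK.1.le.edgeSet_mono he'
      simpa using ⟨(hs e heC).1, (hKmem e heC).1 he'⟩
  rw [Set.ncard_eq_toFinset_card _ hSf]
  refine ⟨fun hy => ?_, fun hy => ?_, hg⟩
  · have hyS : y ∈ hSf.toFinset := by simpa using ⟨h.right_mem, hy⟩
    rw [hcard, ← Finset.add_sum_erase _ _ hyS, if_pos rfl, Finset.sum_const_nat (m := 2),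
      ← Finset.card_erase_add_one hyS]
    · ring
    · intro v hv
      rw [if_neg (Finset.ne_of_mem_erase hv)]
  · rw [hcard, Finset.sum_const_nat (m := 2), mul_comm]
    intro v hv
    rw [if_neg]
    rintro rfl
    exact hy (by simpa using (show v ∈ J ∩ K.vertexSet by simpa using hv).2)

lemma exists_xuongTree (h : G.NearIndepPartition A J g x y) (hV : G.vertexSet.Finite)
    (hE : G.edgeSet.Finite) (hconn : G.IsConn) (hcubic : G.IsCubicGraph) (hloop : G.Loopless)
    (h4 : 4 ∣ G.vertexSet.ncard) :
    ∃ T : Graph α β, G.IsXuongTree T ∧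
      ∃ K : Graph α β, K.IsOddComponent (G.cotree T) ∧
        (∀ K' : Graph α β, K'.IsOddComponent (G.cotree T) → K' = K) ∧ G.IsHeavy K := by
  obtain ⟨f, T, hT, hf, hTl⟩ := h.exists_spanningTree hcubic hloop
  have key := fun K hK => h.ncard_component hV hE hcubic hloop hf hTl (K := K) hK
  have hyC : y ∈ (G.cotree T).vertexSet := h.isLink.right_mem
  have hK := isComponent_componentOf hyC
  set K := (G.cotree T).componentOf y with hKdef
  have hyK : y ∈ K.vertexSet := .refl
  obtain ⟨k1, -, hg⟩ := key K hK
  have hcard := k1 hyK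
  have hxK : x ∈ K.vertexSet := .single ⟨g, hg.symm⟩
  -- The component contains both ends of `g`, so it has at least 2 · 2 - 1 = 3 edges.
  have htwo : 2 ≤ (J ∩ K.vertexSet).ncard := by
    rw [← Set.ncard_pair h.ne]
    refine Set.ncard_le_ncard ?_ (hV.subset fun v hv => h.subset_right hv.1)
    rintro v (rfl | rfl)
    exacts [⟨h.left_mem, hxK⟩, ⟨h.right_mem, hyK⟩]
  have hodd : Odd K.edgeSet.ncard := ⟨(J ∩ K.vertexSet).ncard - 1, by omega⟩
  have huniq : ∀ K' : Graph α β, K'.IsOddComponent (G.cotree T) → K' = K := by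
    rintro K' ⟨hK', hodd'⟩
    have hy : y ∈ K'.vertexSet := by
      by_contra hy
      rw [(key K' hK').2.1 hy] at hodd'
      exact Nat.not_odd_iff_even.2 (even_two_mul _) hodd'
    exact hK'.eq_componentOf hy
  obtain ⟨R, hR⟩ := h.exists_two_face hV hE hconn hcubic h4
  refine ⟨T, ⟨hT, ?_⟩, K, ⟨hK, hodd⟩, huniq, by omega, ?_⟩
  · have : {K : Graph α β | K.IsOddComponent (G.cotree T)} = {K} :=
      Set.ext fun K' => ⟨huniq K', by rintro rfl; exact ⟨hK, hodd⟩⟩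
    rw [this, Set.ncard_singleton, deficiency_eq_one hV hE hconn hcubic hR, Nat.cast_one]
  · rw [hcubic.four_dvd_iff hV hE, Nat.even_iff] at h4
    rw [bettiNumber, Nat.even_iff, Int.even_iff]
    rw [Nat.odd_iff] at hodd
    omega

end NearIndepPartition

end Graph

/-! ### From a heavy odd cotree component to a decycling partition -/

namespace Graph

variable {α β : Type*} {G : Graph α β}

open Relation

/-- A connected graph with at least two edges has a vertex incident with two edges. -/
lemma exists_two_edges {K : Graph α β} (hconn : K.IsConn) (h2 : 1 < K.edgeSet.ncard) :
    ∃ z ∈ K.vertexSet, ∃ e f, e ≠ f ∧ K.Inc e z ∧ K.Inc f z := by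
  obtain ⟨e, he⟩ : K.edgeSet.Nonempty := by
    by_contra h
    rw [Set.not_nonempty_iff_eq_empty] at h
    rw [h] at h2
    simp at h2
  obtain ⟨f, hf, hfe⟩ := Set.exists_ne_of_one_lt_ncard h2 e
  obtain ⟨u, v, huv⟩ := exists_isLink_of_mem_edgeSet he
  obtain ⟨w, w', hw⟩ := exists_isLink_of_mem_edgeSet hf
  have hinc : ∀ a ∈ ({u, v} : Set α), K.Inc e a := by
    rintro a (rfl | rfl)
    exacts [huv.inc_left, huv.inc_right]
  by_cases hwS : w ∈ ({u, v} : Set α)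
  · exact ⟨w, hw.left_mem, e, f, hfe.symm, hinc w hwS, hw.inc_left⟩
  · obtain ⟨a, ha, b, hb, e', hl⟩ :=
      exists_crossing (hconn.2 u huv.left_mem w hw.left_mem) (Or.inl rfl) hwS
    refine ⟨a, hl.left_mem, e, e', ?_, hinc a ha, hl.inc_left⟩
    rintro rfl
    rcases hl.inc_right.eq_or_eq_of_isLink huv with rfl | rfl
    exacts [hb (.inl rfl), hb (.inr rfl)]

/-- Deleting a set of pairwise nonadjacent leaves from a spanning tree, when all other edges meet
that set, leaves an induced tree. -/
lemma IsSpanningTree.isTreeGraph_induce {T : Graph α β} (hT : G.IsSpanningTree T) {A : Set α}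
    (hA : A ⊆ G.vertexSet) (hne : A.Nonempty)
    (hleaf : ∀ v ∈ G.vertexSet, v ∉ A → ∃ f a, a ∈ A ∧ T.IsLink f v a ∧ ∀ f', T.Inc f' v → f' = f)
    (hcover : ∀ e u v, G.IsLink e u v → u ∈ A → v ∈ A → e ∈ T.edgeSet) :
    (G.induce A).IsTreeGraph := by
  classical
  obtain ⟨⟨hle, hVT⟩, hTconn, hTb⟩ := hT
  have hTlink : ∀ e u v, G.IsLink e u v → u ∈ A → v ∈ A → T.IsLink e u v :=
    fun e u v h hu hv => (hle.isLink_iff (hcover e u v h hu hv)).2 h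
  have hex : ∀ v, ∃ a, v ∈ G.vertexSet → v ∉ A →
      a ∈ A ∧ ∀ f' w, T.IsLink f' v w → w = a := by
    intro v
    by_cases hv : v ∈ G.vertexSet ∧ v ∉ A
    · obtain ⟨f, a, ha, hfa, huniq⟩ := hleaf v hv.1 hv.2
      refine ⟨a, fun _ _ => ⟨ha, fun f' w hw => ?_⟩⟩
      obtain rfl := huniq f' hw.inc_left
      exact hw.right_unique hfa
    · exact ⟨v, fun h h' => absurd ⟨h, h'⟩ hv⟩
  choose p hp using hex
  refine ⟨⟨hne, ?_⟩, ?_⟩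
  -- As before, leaves are folded onto their neighbours in `A`.
  · have hproj : ∀ u v, ReflTransGen T.Adj u v → ReflTransGen (G.induce A).Adj
        (if u ∈ A then u else p u) (if v ∈ A then v else p v) := by
      intro u v huv
      induction huv with
      | refl => exact .refl
      | @tail c d _ hcd ih =>
        refine ih.trans ?_
        obtain ⟨e, hl⟩ := hcd
        have hc := (hl.mono hle).left_mem
        have hd := (hl.mono hle).right_mem
        by_cases hcA : c ∈ A
        · by_cases hdA : d ∈ A
          · rw [if_pos hcA, if_pos hdA]
            exact .single ⟨e, hl.mono hle, hcA, hdA⟩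
          · rw [if_pos hcA, if_neg hdA, ← (hp d hd hdA).2 e c hl.symm]
        · have hpc := hp c hc hcA
          have hdp := hpc.2 e d hl
          rw [if_neg hcA, if_pos (hdp ▸ hpc.1), hdp]
    intro u hu v hv
    have := hproj u v (hTconn.2 u (hVT ▸ hA hu) v (hVT ▸ hA hv))
    rwa [if_pos (show u ∈ A from hu), if_pos (show v ∈ A from hv)] at this
  · intro e he
    obtain ⟨u, v, h, hu, hv⟩ := exists_isLink_of_mem_edgeSet he
    have hTl := hTlink e u v h hu hv
    refine ⟨u, v, ⟨h, hu, hv⟩, fun hr => (hTb e hTl.edge_mem).not_reach hTl ?_⟩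
    refine reach_of_imp ?_ hr
    rintro c d ⟨e', ⟨hl, hc, hd⟩, hne'⟩
    exact ⟨e', hTlink e' c d hl hc hd, hne'⟩

/-- At a vertex with a loop the only other edge belongs to the tree. The loop is then a cotree
component with one edge, odd but too small to be `K`. -/
lemma loopless_of_heavy (hE : G.edgeSet.Finite) (hcubic : G.IsCubicGraph)
    (hV : 2 ≤ G.vertexSet.ncard) {T K : Graph α β} (hT : G.IsSpanningTree T)
    (huniq : ∀ K' : Graph α β, K'.IsOddComponent (G.cotree T) → K' = K)
    (hK : 3 ≤ K.edgeSet.ncard) : G.Loopless := by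
  refine ⟨fun e v hl => ?_⟩
  have hv : v ∈ G.vertexSet := hl.vertex_mem
  have hTl : ∀ w, ¬ T.IsLoopAt e w := fun w h =>
    (hT.2.2 e h.edge_mem).not_reach h .refl
  have heT : e ∉ T.edgeSet := by
    intro he
    obtain ⟨a, b, hab⟩ := exists_isLink_of_mem_edgeSet he
    rcases (hab.mono hT.1.le).eq_and_eq_or_eq_and_eq hl with ⟨rfl, rfl⟩ | ⟨rfl, rfl⟩ <;>
      exact hTl _ hab
  obtain ⟨w, hw, hwv⟩ := Set.exists_ne_of_one_lt_ncard hV v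
  have hreach : ReflTransGen T.Adj v w :=
    hT.2.1.2 v (hT.1.vertexSet_eq ▸ hv) w (hT.1.vertexSet_eq ▸ hw)
  obtain ⟨v', hv', b, hb, f, hf⟩ := exists_crossing (S := {v}) hreach rfl (by simpa using hwv)
  rw [Set.mem_singleton_iff.1 hv'] at hf
  have hdeg := hcubic _ hv
  rw [vertexDegree] at hdeg
  have fN : {e | G.IsNonloopAt e v}.Finite := hE.subset fun e h => h.edge_mem
  have fL : {e | G.IsLoopAt e v}.Finite := hE.subset fun e h => h.edge_mem
  have hfN : f ∈ {e | G.IsNonloopAt e v} := ⟨b, hb, hf.mono hT.1.le⟩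
  have hN := (Set.ncard_pos fN).2 ⟨f, hfN⟩
  have hL := (Set.ncard_pos fL).2 ⟨e, hl⟩
  have hN1 : {e | G.IsNonloopAt e v}.ncard ≤ 1 := by omega
  have hL1 : {e | G.IsLoopAt e v}.ncard ≤ 1 := by omega
  rw [Set.ncard_le_one fN] at hN1
  rw [Set.ncard_le_one fL] at hL1
  have hCinc : ∀ e', (G.cotree T).Inc e' v → e' = e := by
    intro e' he'
    rw [cotree_inc] at he'
    rcases he'.1.isLoopAt_or_isNonloopAt with h | h
    · exact hL1 e' h e hl
    · exact absurd (hN1 e' h f hfN ▸ hf.edge_mem) he'.2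
  have hvC : v ∈ (G.cotree T).vertexSet := hv
  have hcomp : ((G.cotree T).componentOf v).edgeSet = {e} := by
    have hone : ∀ w, ReflTransGen (G.cotree T).Adj v w → w = v := by
      intro w hw
      by_contra hne
      obtain ⟨_, rfl, b', hb', e', he'⟩ := exists_crossing (S := {v}) hw rfl hne
      obtain rfl := hCinc e' he'.inc_left
      rcases he'.1.eq_and_eq_or_eq_and_eq hl with h | h <;> exact hb' h.2
    ext e'
    constructor
    · rintro ⟨p, q, h, hp, -⟩
      exact hCinc e' (hone p hp ▸ h.inc_left)
    · rintro rfl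
      exact ⟨v, v, ⟨hl, heT⟩, .refl, .refl⟩
  have := huniq _ ⟨isComponent_componentOf hvC, by rw [hcomp]; simp⟩
  rw [← this, hcomp, Set.ncard_singleton] at hK
  omega

/-- Deficiency 1 makes m - n equal to twice the maximum genus. -/
lemma four_dvd_of_deficiency_eq_one (hV : G.vertexSet.Finite) (hE : G.edgeSet.Finite)
    (hcubic : G.IsCubicGraph) (h : G.deficiency = 1) : 4 ∣ G.vertexSet.ncard := by
  rw [hcubic.four_dvd_iff hV hE, Nat.even_iff]
  rw [deficiency, bettiNumber] at h
  omega

/-- From a spanning tree whose cotree has a single odd component, which has at least three edges,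
to an induced tree whose complement spans a single edge. -/
lemma exists_partition_of_tree (hV : G.vertexSet.Finite) (hE : G.edgeSet.Finite)
    (hconn : G.IsConn) (hcubic : G.IsCubicGraph) (h4 : 4 ∣ G.vertexSet.ncard) (hloop : G.Loopless)
    {T K : Graph α β} (hT : G.IsSpanningTree T) (hK : K.IsOddComponent (G.cotree T))
    (huniq : ∀ K' : Graph α β, K'.IsOddComponent (G.cotree T) → K' = K)
    (hK3 : 3 ≤ K.edgeSet.ncard) : ∃ A J : Set α, G.IsCoherentDecyclingPartition A J := by
  classical
  set C := G.cotree T with hC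
  have hn : 4 ≤ G.vertexSet.ncard :=
    Nat.le_of_dvd ((Set.ncard_pos hV).2 hconn.1) h4
  have hCE : C.edgeSet.Finite := hE.subset cotree_le.edgeSet_mono
  have hCV : C.vertexSet = G.vertexSet := rfl
  have hTV := hT.1.vertexSet_eq
  have hincfin : ∀ v, {e | G.Inc e v}.Finite := fun v => hE.subset fun e h => h.edge_mem
  have hG3 : ∀ v ∈ G.vertexSet, {e | G.Inc e v}.ncard = 3 := fun v hv => by
    rw [← vertexDegree_eq_ncard_inc (fun e => hloop.not_isLoopAt e v), hcubic v hv]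
  -- With at least four vertices, the tree leaves any set of one or two of them: every vertex has a
  -- tree edge, and no two leaves are adjacent in the tree.
  have hTexit : ∀ S ⊆ G.vertexSet, S.Nonempty → S.ncard ≤ 2 →
      ∃ a ∈ S, ∃ b ∉ S, T.Adj a b := by
    rintro S hS ⟨r, hr⟩ hS2
    obtain ⟨w, hw, hwS⟩ : ∃ w ∈ G.vertexSet, w ∉ S := by
      by_contra! h
      have := Set.ncard_le_ncard (show G.vertexSet ⊆ S from h) (hV.subset hS)
      omega
    exact exists_crossing (hT.2.1.2 r (hTV ▸ hS hr) w (hTV ▸ hw)) hr hwS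
  have hsplit : ∀ v, {e | G.Inc e v} = {e | C.Inc e v} ∪ {e | T.Inc e v} := by
    intro v
    ext e
    constructor
    · intro he
      by_cases heT : e ∈ T.edgeSet
      · exact .inr ((hT.1.le.inc_congr heT).2 he)
      · exact .inl (cotree_inc.2 ⟨he, heT⟩)
    · rintro (h | h)
      exacts [h.mono cotree_le, h.mono hT.1.le]
  have hTfin : ∀ v, {e | T.Inc e v}.Finite := fun v =>
    (hincfin v).subset fun e h => h.mono hT.1.le
  have hCfin : ∀ v, {e | C.Inc e v}.Finite := fun v =>
    (hincfin v).subset fun e h => h.mono cotree_le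
  have hcount : ∀ v ∈ G.vertexSet, {e | C.Inc e v}.ncard + {e | T.Inc e v}.ncard = 3 := by
    intro v hv
    rw [← hG3 v hv, hsplit v, Set.ncard_union_eq ?_ (hCfin v) (hTfin v)]
    rw [Set.disjoint_left]
    exact fun e he he' => (cotree_inc.1 he).2 he'.edge_mem
  have hC2 : ∀ v ∈ G.vertexSet, {e | C.Inc e v}.ncard ≤ 2 := by
    intro v hv
    obtain ⟨v', hv', b, -, f, hf⟩ := hTexit {v} (by simpa using hv) (by simp) (by simp)
    rw [Set.mem_singleton_iff.1 hv'] at hf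
    have := (Set.ncard_pos (hTfin v)).2 ⟨f, hf.inc_left⟩
    have := hcount v hv
    omega
  -- a vertex of the odd component with two cotree edges
  obtain ⟨z, hzK, e₁', e₂', hne', h₁', h₂'⟩ := exists_two_edges hK.1.2 (by omega)
  have hzC : z ∈ C.vertexSet := hK.1.1.le.vertexSet_mono hzK
  have hDz : {e | C.Inc e z}.ncard = 2 := by
    refine le_antisymm (hC2 z hzC) ?_
    rw [← Set.ncard_pair hne']
    refine Set.ncard_le_ncard ?_ (hCfin z)
    rintro e (rfl | rfl)
    exacts [h₁'.mono hK.1.1.le, h₂'.mono hK.1.1.le]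
  have hKz : K = C.componentOf z := hK.1.eq_componentOf hzK
  have : Nonempty α := ⟨z⟩
  -- Odd at `z` and even elsewhere is consistent, since the component of `z` is the only odd one.
  obtain ⟨s, hs, hpar⟩ := exists_assignment (G := C) (V := hV.toFinset) (E := hCE.toFinset)
    (by simp [hCV]) (by simp) (fun a => if z = a then 1 else 0) (by
      intro v hv X hX
      have hvC : v ∈ C.vertexSet := by
        rw [hCV]
        simpa using hv
      have hzX : z ∈ X ↔ ReflTransGen C.Adj v z := by rw [← Finset.mem_coe, hX]; rfl
      rw [Finset.sum_ite_eq]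
      by_cases hvz : ReflTransGen C.Adj v z
      · rw [if_pos (hzX.2 hvz)]
        have hKv : K = C.componentOf v := hK.1.eq_componentOf (by
          rw [hKz]
          exact reach_symm hvz)
        rw [← hKv]
        exact ((ZMod.natCast_eq_one_iff_odd).2 hK.2).symm
      · rw [if_neg (hzX.not.2 hvz)]
        refine ((ZMod.natCast_eq_zero_iff_even).2 ?_).symm
        by_contra hodd
        rw [Nat.not_even_iff_odd] at hodd
        have := huniq _ ⟨isComponent_componentOf hvC, hodd⟩
        have hz : z ∈ (C.componentOf v).vertexSet := this ▸ hzK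
        exact hvz hz)
  have hs' : ∀ e ∈ C.edgeSet, C.Inc e (s e) := fun e he => hs e (by simpa using he)
  set P : α → Set β := fun v => {e | e ∈ C.edgeSet ∧ s e = v} with hP
  have hPsub : ∀ v, P v ⊆ {e | C.Inc e v} := by
    rintro v e ⟨he, rfl⟩
    exact hs' e he
  have hPfin : ∀ v, (P v).Finite := fun v => (hCfin v).subset (hPsub v)
  have hPpar : ∀ v ∈ G.vertexSet, ((P v).ncard : ZMod 2) = if z = v then 1 else 0 := by
    intro v hv
    rw [← hpar v (by simpa using hv), Finset.sum_boole, ← Set.ncard_coe_finset]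
    congr 2
    ext e
    simp [hP]
  have hPle : ∀ v ∈ G.vertexSet, (P v).ncard ≤ 2 := fun v hv =>
    (Set.ncard_le_ncard (hPsub v) (hCfin v)).trans (hC2 v hv)
  have hPz : (P z).ncard = 1 := by
    have h1 := hPpar z hzC
    rw [if_pos rfl, ZMod.natCast_eq_one_iff_odd, Nat.odd_iff] at h1
    have := hPle z hzC
    omega
  -- An even positive number of at most two cotree edges is all of them.
  have hPv : ∀ v ∈ G.vertexSet, v ≠ z → (P v).Nonempty → P v = {e | C.Inc e v} := by
    intro v hv hvz hne
    have h1 := hPpar v hv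
    rw [if_neg hvz.symm, ZMod.natCast_eq_zero_iff_even, Nat.even_iff] at h1
    have h2 := (Set.ncard_pos (hPfin v)).2 hne
    have h3 := hC2 v hv
    exact Set.eq_of_subset_of_ncard_le (hPsub v) (by omega) (hCfin v)
  set J : Set α := {v | v ∈ G.vertexSet ∧ (P v).Nonempty} with hJ
  have hzJ : z ∈ J := ⟨hzC, (Set.ncard_pos (hPfin z)).1 (by omega)⟩
  have hDJ : ∀ v ∈ J, {e | C.Inc e v}.ncard = 2 := by
    rintro v ⟨hv, hne⟩
    by_cases hvz : v = z
    · rw [hvz, hDz]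
    · have h1 := hPpar v hv
      rw [if_neg (Ne.symm hvz), ZMod.natCast_eq_zero_iff_even, Nat.even_iff] at h1
      have h2 := (Set.ncard_pos (hPfin v)).2 hne
      have h3 := hPle v hv
      rw [← hPv v hv hvz hne]
      omega
  have hTone : ∀ v ∈ J, ∃ f, {e | T.Inc e v} = {f} := by
    intro v hv
    have h1 := hDJ v hv
    have h2 := hcount v hv.1
    exact Set.ncard_eq_one.1 (by omega)
  -- Vertices of `J` have a single tree edge, and two such vertices joined by it would be cut off
  -- from the rest of the tree.
  have hTJ : ∀ f u v, T.IsLink f u v → u ∈ J → v ∉ J := by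
    intro f u v hf hu hv
    obtain ⟨a, ha, b, hb, e, he⟩ := hTexit {u, v}
      (by rintro w (rfl | rfl); exacts [hu.1, hv.1]) ⟨u, .inl rfl⟩
      ((Set.ncard_insert_le u {v}).trans (by simp))
    have haJ : a ∈ J := by
      rcases ha with rfl | rfl
      exacts [hu, hv]
    have hfa : T.Inc f a := by
      rcases ha with rfl | rfl
      exacts [hf.inc_left, hf.inc_right]
    obtain ⟨f', hf'⟩ := hTone a haJ
    have h1 : f ∈ {e | T.Inc e a} := hfa
    have h2 : e ∈ {e | T.Inc e a} := he.inc_left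
    rw [hf'] at h1 h2
    have hef : e = f := h2.trans h1.symm
    rcases (hef ▸ he.inc_right : T.Inc f b).eq_or_eq_of_isLink hf with rfl | rfl
    exacts [hb (.inl rfl), hb (.inr rfl)]
  have hCJ : ∀ e ∈ C.edgeSet, s e ∈ J := fun e he => ⟨(hs' e he).vertex_mem, e, he, rfl⟩
  -- the second cotree edge at `z`
  obtain ⟨e₁, he₁⟩ := Set.ncard_eq_one.1 hPz
  have he₁P : e₁ ∈ P z := by rw [he₁]; rfl
  obtain ⟨e₂, he₂, hne⟩ := Set.exists_ne_of_one_lt_ncard (s := {e | C.Inc e z}) (by omega) e₁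
  have hDz' : {e | C.Inc e z} = {e₁, e₂} := by
    refine (Set.eq_of_subset_of_ncard_le ?_ ?_ (hCfin z)).symm
    · rintro e (rfl | rfl)
      exacts [hPsub z he₁P, he₂]
    · rw [hDz, Set.ncard_pair hne.symm]
  have hse₂ : s e₂ ≠ z := by
    intro h
    have : e₂ ∈ P z := ⟨he₂.edge_mem, h⟩
    rw [he₁] at this
    exact hne this
  -- A vertex of `J` other than `z` owns all of its cotree edges, and `z` owns all but `e₂`; so any
  -- other cotree edge has only its owner in `J`.
  have hother : ∀ e ∈ C.edgeSet, e ≠ e₂ → ∀ w, C.Inc e w → w ≠ s e → w ∉ J := by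
    intro e he hee w hw hws hwJ
    by_cases hwz : w = z
    · have h1 : e ∈ {e | C.Inc e z} := hwz ▸ hw
      rw [hDz'] at h1
      obtain rfl := h1.resolve_right hee
      exact hws (hwz.trans he₁P.2.symm)
    · have h1 : e ∈ P w := by
        rw [hPv w hwJ.1 hwz hwJ.2]
        exact hw
      exact hws h1.2.symm
  have hlinkJ : ∀ e u v, G.IsLink e u v → u ∈ J → v ∈ J → e = e₂ := by
    intro e u v hl hu hv
    by_contra hee
    by_cases heT : e ∈ T.edgeSet
    · exact hTJ e u v ((hT.1.le.isLink_iff heT).2 hl) hu hv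
    · have hCl : C.IsLink e u v := ⟨hl, heT⟩
      have huv : u ≠ v := by
        rintro rfl
        exact hloop.not_isLoopAt e u hl
      by_cases hsu : u = s e
      · exact hother e hCl.edge_mem hee v hCl.inc_right (fun h => huv (hsu.trans h.symm)) hv
      · exact hother e hCl.edge_mem hee u hCl.inc_left hsu hu
  have hJV : J ⊆ G.vertexSet := fun v hv => hv.1
  refine ⟨G.vertexSet \ J, J, Set.sdiff_union_of_subset hJV, Set.disjoint_sdiff_left, ?_, .inr ?_⟩
  · refine hT.isTreeGraph_induce Set.sdiff_subset ?_ ?_ ?_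
    · obtain ⟨f, hf⟩ := hTone z hzJ
      obtain ⟨w, hw⟩ : T.Inc f z := by
        change f ∈ {e | T.Inc e z}
        rw [hf]
        rfl
      exact ⟨w, hTV ▸ hw.right_mem, hTJ f z w hw hzJ⟩
    · intro v hv hvA
      have hvJ : v ∈ J := by
        by_contra h
        exact hvA ⟨hv, h⟩
      obtain ⟨f, hf⟩ := hTone v hvJ
      obtain ⟨w, hw⟩ : T.Inc f v := by
        change f ∈ {e | T.Inc e v}
        rw [hf]
        rfl
      refine ⟨f, w, ⟨hTV ▸ hw.right_mem, hTJ f v w hw hvJ⟩, hw, fun f' hf' => ?_⟩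
      have : f' ∈ {e | T.Inc e v} := hf'
      rwa [hf] at this
    -- Every cotree edge has its owner in `J`, so edges within the complement of `J` are tree edges.
    · intro e u v hl hu hv
      by_contra heT
      have hCl : C.IsLink e u v := ⟨hl, heT⟩
      have := hCJ e hCl.edge_mem
      rcases (hs' e hCl.edge_mem).eq_or_eq_of_isLink hCl with h | h
      · exact hu.2 (h ▸ this)
      · exact hv.2 (h ▸ this)
  · rw [IsNearIndepVertexSet, Set.ncard_eq_one]
    refine ⟨e₂, Set.ext fun e => ⟨?_, ?_⟩⟩
    · rintro ⟨u, v, hl, hu, hv⟩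
      exact hlinkJ e u v hl hu hv
    · rintro rfl
      -- Not being owned by `z`, the edge is owned by its other end, which therefore lies in `J`.
      obtain ⟨w, hw⟩ := he₂
      have hsw : s e = w := ((hs' e hw.edge_mem).eq_or_eq_of_isLink hw).resolve_left hse₂
      exact ⟨z, w, hw.1, hzJ, hsw ▸ hCJ e hw.edge_mem⟩

end Graph

theorem theorem4p3 {α β : Type*} (G : Graph α β) (hV : G.vertexSet.Finite)
    (hE : G.edgeSet.Finite) (hconn : G.IsConn) (hcubic : G.IsCubicGraph) :
    List.TFAE [
      G.IsAmplyTwoFaceEmbeddable,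
      ∃ T : Graph α β, G.IsXuongTree T ∧
        ∃ K : Graph α β, K.IsOddComponent (G.cotree T) ∧
          (∀ K' : Graph α β, K'.IsOddComponent (G.cotree T) → K' = K) ∧ G.IsHeavy K,
      G.Loopless ∧ 4 ∣ G.vertexSet.ncard ∧
        ∃ A J : Set α, G.IsCoherentDecyclingPartition A J] := by
  tfae_have 1 → 3 := fun h => h.exists_partition hV hE hcubic
  tfae_have 3 → 1 := by
    rintro ⟨hloop, h4, A, J, h⟩
    obtain ⟨g, x, y, h⟩ := h.nearIndep hV hE hconn hcubic hloop h4
    exact h.isAmplyTwoFaceEmbeddable hV hE hconn hcubic hloop h4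
  tfae_have 3 → 2 := by
    rintro ⟨hloop, h4, A, J, h⟩
    obtain ⟨g, x, y, h⟩ := h.nearIndep hV hE hconn hcubic hloop h4
    exact h.exists_xuongTree hV hE hconn hcubic hloop h4
  tfae_have 2 → 3 := by
    rintro ⟨T, ⟨hT, hdef⟩, K, hK, huniq, hK3, -⟩
    have hone : {K : Graph α β | K.IsOddComponent (G.cotree T)} = {K} :=
      Set.ext fun K' => ⟨huniq K', by rintro rfl; exact hK⟩
    rw [hone, Set.ncard_singleton, Nat.cast_one] at hdef
    have h4 := Graph.four_dvd_of_deficiency_eq_one hV hE hcubic hdef.symm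
    have hn := Nat.le_of_dvd ((Set.ncard_pos hV).2 hconn.1) h4
    have hloop := Graph.loopless_of_heavy hE hcubic (by omega) hT huniq hK3
    exact ⟨hloop, h4,
      Graph.exists_partition_of_tree hV hE hconn hcubic h4 hloop hT hK huniq hK3⟩
  tfae_finish
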